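/- Let $G=(V,E)$ be a finite simple undirected graph with $n$ vertices, and let $s\in V$. For a subgraph $H\subseteq G$ (on the same vertex set), an edge $e$ is *protected* in $H$ if $\mathrm{dist}(s,v,H\setminus\{e\})=\mathrm{dist}(s,v,G\setminus\{e\})$ for every $v\in V$, where $\mathrm{dist}$ counts edges and is $\infty$ between vertices in different components; otherwise $e$ is *unprotected*. A *$(b,r)$ FT-BFS structure* of $G$ with respect to $s$ is a subgraph $H\subseteq G$ together with a set $E'\subseteq E(H)$ of at most $r$ reinforced edges such that $|E(H)\setminus E'|\le b$ and $\mathrm{dist}(s,v,H\setminus\{e\})\le \mathrm{dist}(s,v,G\setminus\{e\})$ for every $v\in V$ and every $e\in E(G)\setminus E'$. Logarithms are binary. "In polynomial time" refers to one unit-cost random access program (with addition and truncated subtraction of natural numbers, and comparison of the real input $\epsilon$ with rational numbers) that works for all inputs $(G,s,\epsilon)$ and halts within a number of steps bounded by a fixed polynomial in $n$. **Theorem.** There is an absolute constant $C$ such that the following two statements hold. 1. For every $n$-vertex graph $G$, source $s$ and real $\epsilon\in(0,1]$, one can construct in polynomial time a subgraph $H\subseteq G$ with $$|E(H)|\le C\cdot\min\Big\{\tfrac1{\epsilon'}\cdot\log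 n\cdot n^{1+\epsilon'},\ n^{3/2}\Big\},\qquad \epsilon'=\epsilon+\frac{\log(\log n/\epsilon)}{\log n},$$ such that at most $C\cdot n^{1-\epsilon}$ edges of $G$ are unprotected in $H$. (For $n=1$, where $\epsilon'$ is not defined, there are no edges and the claim is trivial.) 2. For every $n$-vertex graph $G$, source $s$ and real $\epsilon\in(0,1]$, one can construct in polynomial time a $(b,r)$ FT-BFS structure of $G$ with respect to $s$ (that is, both $H$ and $E'$) with $$b= C\cdot\min\Big\{\tfrac1\epsilon\cdot n^{1+\epsilon}\cdot\log n,\ n^{3/2}\Big\},\qquad r= C\cdot\tfrac1\epsilon\cdot n^{1-\epsilon}\cdot\log n .$$ -/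

import Mathlib

namespace FTBFS

/-! ## Fault-tolerant BFS structures

Distances are extended distances (`SimpleGraph.edist`, in `ℕ∞`), so that the distance of two
vertices in different components is `⊤`. -/

/-- The edge `e` is protected in the subgraph `H` of `G` with respect to the source `s`: after the
failure of `e`, all distances from `s` are the same in `H` as in `G`. -/
def Protected {V : Type*} (G H : SimpleGraph V) (s : V) (e : Sym2 V) : Prop :=
  ∀ v : V, (H.deleteEdges {e}).edist s v = (G.deleteEdges {e}).edist s v

/-- The set of edges of `G` that are not protected in `H`. -/
def unprotected {V : Type*} (G H : SimpleGraph V) (s : V) : Set (Sym2 V) :=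
  {e | e ∈ G.edgeSet ∧ ¬ Protected G H s e}

/-- `H`, with the set `R` of reinforced edges, is a `(b, r)` FT-BFS structure of `G` with source
`s`: `H` is a subgraph of `G`, `R` is a set of at most `r` edges of `H`, at most `b` edges of `H`
are backup edges (not reinforced), and after the failure of any single edge outside `R` no distance
from `s` is larger in `H` than in `G`. -/
structure IsFTBFS {V : Type*} (G H : SimpleGraph V) (s : V) (R : Set (Sym2 V)) (b r : ℝ) :
    Prop where
  le : H ≤ G
  subset : R ⊆ H.edgeSet
  backup : ((H.edgeSet \ R).ncard : ℝ) ≤ b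
  reinforced : (R.ncard : ℝ) ≤ r
  dist_le : ∀ e ∈ G.edgeSet \ R, ∀ v : V,
    (H.deleteEdges {e}).edist s v ≤ (G.deleteEdges {e}).edist s v

/-- The binary logarithm of a natural number. -/
noncomputable def lg (n : ℕ) : ℝ := Real.logb 2 n

/-- The number `ε' = ε + log (log n / ε) / log n`. -/
noncomputable def epsPrime (n : ℕ) (ε : ℝ) : ℝ := ε + Real.logb 2 (lg n / ε) / lg n

/-! ## A random access machine with a step count

The programs are structured programs over finitely many variables and finitely many
two-dimensional arrays, all with natural number entries. The only arithmetic operations are addition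
and truncated subtraction (there is no multiplication, so that unit cost is a fair measure). One
real number is part of the input; it can only be compared with the rational numbers that the machine
has computed. -/

/-- Arithmetic expressions. -/
inductive Expr : Type
  | const (c : ℕ)
  | var (x : ℕ)
  | read (a : ℕ) (i j : Expr)
  | add (p q : Expr)
  | sub (p q : Expr)
  | realLe (p q : Expr)

/-- Programs. -/
inductive Prog : Type
  | skip
  | assign (x : ℕ) (p : Expr)
  | write (a : ℕ) (i j p : Expr)
  | seq (P Q : Prog)
  | ite (p : Expr) (P Q : Prog)
  | while (p : Expr) (P : Prog)

/-- The content of the memory: the values of the variables and the entries of the arrays. -/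
structure State where
  vars : ℕ → ℕ
  arrays : ℕ → ℕ → ℕ → ℕ

/-- The number of operations in an expression. -/
def Expr.cost : Expr → ℕ
  | .const _ => 1
  | .var _ => 1
  | .read _ i j => i.cost + j.cost + 1
  | .add p q => p.cost + q.cost + 1
  | .sub p q => p.cost + q.cost + 1
  | .realLe p q => p.cost + q.cost + 1

open Classical in
/-- The value of an expression, where `ε` is the real number in the input. The expression
`realLe p q` has the value `1` if `ε * p ≤ q`, and `0` otherwise. -/
noncomputable def Expr.eval (ε : ℝ) (σ : State) : Expr → ℕ
  | .const c => c
  | .var x => σ.vars x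
  | .read a i j => σ.arrays a (i.eval ε σ) (j.eval ε σ)
  | .add p q => p.eval ε σ + q.eval ε σ
  | .sub p q => p.eval ε σ - q.eval ε σ
  | .realLe p q => if ε * (p.eval ε σ : ℝ) ≤ (q.eval ε σ : ℝ) then 1 else 0

/-- The memory after the variable `x` has got the value `m`. -/
def State.setVar (σ : State) (x m : ℕ) : State :=
  ⟨Function.update σ.vars x m, σ.arrays⟩

/-- The memory after the entry `(i, j)` of the array `a` has got the value `m`. -/
def State.setEntry (σ : State) (a i j m : ℕ) : State :=
  ⟨σ.vars, Function.update σ.arrays a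
    (Function.update (σ.arrays a) i (Function.update (σ.arrays a i) j m))⟩

/-- `Exec ε P σ t τ`: with the real input `ε`, the program `P`, started in the state `σ`, halts
after `t` steps in the state `τ`. Conditions are true when they are not `0`. -/
inductive Exec (ε : ℝ) : Prog → State → ℕ → State → Prop
  | skip (σ : State) : Exec ε .skip σ 1 σ
  | assign (σ : State) (x : ℕ) (p : Expr) :
      Exec ε (.assign x p) σ (p.cost + 1) (σ.setVar x (p.eval ε σ))
  | write (σ : State) (a : ℕ) (i j p : Expr) :
      Exec ε (.write a i j p) σ (i.cost + j.cost + p.cost + 1)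
        (σ.setEntry a (i.eval ε σ) (j.eval ε σ) (p.eval ε σ))
  | seq {P Q : Prog} {σ ρ τ : State} {t u : ℕ} :
      Exec ε P σ t ρ → Exec ε Q ρ u τ → Exec ε (.seq P Q) σ (t + u) τ
  | ite_true {p : Expr} {P Q : Prog} {σ τ : State} {t : ℕ} :
      p.eval ε σ ≠ 0 → Exec ε P σ t τ → Exec ε (.ite p P Q) σ (p.cost + 1 + t) τ
  | ite_false {p : Expr} {P Q : Prog} {σ τ : State} {t : ℕ} :
      p.eval ε σ = 0 → Exec ε Q σ t τ → Exec ε (.ite p P Q) σ (p.cost + 1 + t) τ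
  | while_true {p : Expr} {P : Prog} {σ ρ τ : State} {t u : ℕ} :
      p.eval ε σ ≠ 0 → Exec ε P σ t ρ → Exec ε (.while p P) ρ u τ →
        Exec ε (.while p P) σ (p.cost + 1 + t + u) τ
  | while_false {p : Expr} {P : Prog} {σ : State} :
      p.eval ε σ = 0 → Exec ε (.while p P) σ (p.cost + 1) σ

open Classical in
/-- The initial memory for a graph `G` on `{0, …, n - 1}` with source `s`: the variable `0` holds
`n`, the variable `1` holds `s`, the array `0` holds the adjacency matrix of `G`, and the rest of
the memory is `0`. -/
noncomputable def inputState {n : ℕ} (G : SimpleGraph (Fin n)) (s : Fin n) : State where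
  vars x := if x = 0 then n else if x = 1 then (s : ℕ) else 0
  arrays a i j :=
    if a = 0 ∧ ∃ (hi : i < n) (hj : j < n), G.Adj ⟨i, hi⟩ ⟨j, hj⟩ then 1 else 0

/-- The array `a` holds, at the entries `(u, v)` with `u, v < n`, the indicator matrix of a set
of edges. -/
def State.Holds {n : ℕ} (σ : State) (a : ℕ) (E : Set (Sym2 (Fin n))) : Prop :=
  ∀ u v : Fin n, (s(u, v) ∈ E → σ.arrays a u v = 1) ∧ (s(u, v) ∉ E → σ.arrays a u v = 0)

/-- On the input `G`, `s`, `ε`, the program `P` halts after at most `T` steps in the state `τ`. -/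
def HaltsWithin (P : Prog) (T : ℕ) {n : ℕ} (G : SimpleGraph (Fin n)) (s : Fin n) (ε : ℝ)
    (τ : State) : Prop :=
  ∃ t ≤ T, Exec ε P (inputState G s) t τ

end FTBFS

/-! Fix a shortest path tree with root `s` and parent map `p`. If the failing edge is not in the
tree, the tree itself keeps all distances. If it is a tree edge `(p x, x)`, it suffices that `H`
contains, for every vertex `v` still reachable, one last edge of a shortest path to `v` in the
remaining graph (`edist_le_of_last_edges`, `edist_le_of_complete`). The algorithm starts with the
tree and goes through the tree edges: it gives up on (or reinforces) those above dense vertices `x`,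
and for the others adds a last edge at each `v` that `H` does not serve yet.

The edges added at `v` are counted by the vertices `x` that caused them (`Trigger`). Since the
algorithm is greedy, among any two of these the last edge of one does not serve for the other. The
replacement path for `x` leaves the tree path to `v` at a branch vertex `b` above `x` and then
avoids the tree path until its last edge; this is its detour. Detours of different `x` are disjoint,
since from a common vertex both tails could be used after both failures (`sat_of_mem_detour`). The
detour of `x` has vertices below `b` at every distance between the depth of `b` and the new distance
of `v`, and `b` is at or below each counted `z` higher up on the path (`Trigger.exists_anc_branch`).

Two counts follow. Long detours are disjoint sets of more than `√n` vertices, so each `v` gets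
`O(√n)` edges (`TriggerFamily.card_le_sqrt`). For the other count, take the `x` whose height above
`v` is in `[l, 2 * l)`, and let `z` be the topmost. All other detours have `l` vertices among the
descendants of `z` of relative depth below `2 * l`; if `z` is not dense there are fewer than `K * 2
* l` of these, so at most `2 * K` such `x` exist. Summing over dyadic scales gives `O(K log n)`
edges at each `v` (`TriggerFamily.card_le_log`). A harmonic charging argument bounds the dense
vertices by `O(n log n / K)` (`card_dense_le`). The threshold `K` is about `n ^ ε * log n` for the
first statement and `n ^ ε` for the second.

For the running time, the algorithm is written in a language of bounded loops with a denotational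
semantics; `Cmd.exec_den` transfers it to the machine with a polynomial step bound, and
`Cmd.loop_induct` carries the correctness proofs. -/

namespace FTBFS

/-! ## Truncated distances -/

section TruncatedDistance

variable {V : Type*}

/-- The distance in `G`, truncated at `k`. -/
noncomputable def tdist (k : ℕ) (G : SimpleGraph V) (a b : V) : ℕ := (min (G.edist a b) k).toNat

theorem coe_tdist (k : ℕ) (G : SimpleGraph V) (a b : V) :
    (tdist k G a b : ℕ∞) = min (G.edist a b) k :=
  ENat.natCast_toNat (ne_top_of_le_ne_top (ENat.natCast_ne_top k) (min_le_right _ _))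

theorem tdist_le_iff {k : ℕ} {G : SimpleGraph V} {a b : V} {m : ℕ} :
    tdist k G a b ≤ m ↔ k ≤ m ∨ G.edist a b ≤ m := by
  rw [← ENat.natCast_le_natCast, coe_tdist, min_le_iff, ENat.natCast_le_natCast, or_comm]

theorem tdist_le (k : ℕ) (G : SimpleGraph V) (a b : V) : tdist k G a b ≤ k :=
  tdist_le_iff.2 (Or.inl le_rfl)

theorem edist_eq_of_tdist_lt {k : ℕ} {G : SimpleGraph V} {a b : V} (h : tdist k G a b < k) :
    G.edist a b = tdist k G a b := by
  rw [← ENat.natCast_lt_natCast, coe_tdist] at h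
  rw [coe_tdist]
  rcases min_lt_iff.1 h with h | h
  · exact (min_eq_left h.le).symm
  · exact absurd h (lt_irrefl _)

theorem tdist_self (k : ℕ) (G : SimpleGraph V) (a : V) : tdist k G a a = 0 :=
  Nat.le_zero.1 (tdist_le_iff.2 (Or.inr (by simp)))

/-- Below the cap both summands are true distances. As the triangle inequality survives truncation,
later comparisons of distances, finite or not, are linear arithmetic in `ℕ`. -/
theorem tdist_triangle (k : ℕ) (G : SimpleGraph V) (a b c : V) :
    tdist k G a c ≤ tdist k G a b + tdist k G b c := by
  rw [tdist_le_iff]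
  by_cases hk : k ≤ tdist k G a b + tdist k G b c
  · exact Or.inl hk
  · right
    have h1 := edist_eq_of_tdist_lt (k := k) (G := G) (a := a) (b := b) (by omega)
    have h2 := edist_eq_of_tdist_lt (k := k) (G := G) (a := b) (b := c) (by omega)
    push_cast
    rw [← h1, ← h2]
    exact SimpleGraph.edist_triangle

theorem tdist_anti (k : ℕ) {G G' : SimpleGraph V} (h : G ≤ G') (a b : V) :
    tdist k G' a b ≤ tdist k G a b := by
  rw [← ENat.natCast_le_natCast, coe_tdist, coe_tdist]
  exact min_le_min_right _ (SimpleGraph.edist_anti h)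

theorem tdist_le_one (k : ℕ) {G : SimpleGraph V} {a b : V} (h : G.Adj a b) :
    tdist k G a b ≤ 1 :=
  tdist_le_iff.2 (Or.inr (by simp [SimpleGraph.edist_eq_one_iff_adj.2 h]))

theorem tdist_adj (k : ℕ) {G : SimpleGraph V} (a : V) {b c : V} (h : G.Adj b c) :
    tdist k G a c ≤ tdist k G a b + 1 :=
  (tdist_triangle k G a b c).trans (Nat.add_le_add_left (tdist_le_one k h) _)

theorem exists_adj_edist {G : SimpleGraph V} {a b : V} {m : ℕ}
    (h : G.edist a b = (m + 1 : ℕ)) : ∃ c, G.Adj c b ∧ G.edist a c ≤ m := by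
  rw [SimpleGraph.edist_comm] at h
  obtain ⟨w, hw⟩ := SimpleGraph.exists_walk_of_edist_eq_coe h
  cases w with
  | nil => simp at hw
  | cons hbc q =>
    refine ⟨_, hbc.symm, ?_⟩
    rw [SimpleGraph.edist_comm]
    have hq : q.length = m := by simpa using hw
    exact hq ▸ SimpleGraph.edist_le q

theorem exists_adj_tdist {k : ℕ} {G : SimpleGraph V} {a b : V} (hab : b ≠ a)
    (h : tdist k G a b < k) : ∃ c, G.Adj c b ∧ tdist k G a c + 1 = tdist k G a b := by
  have he := edist_eq_of_tdist_lt h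
  obtain ⟨m, hm⟩ : ∃ m, tdist k G a b = m + 1 := by
    refine Nat.exists_eq_succ_of_ne_zero fun h0 => hab ?_
    rw [h0] at he
    exact (SimpleGraph.edist_eq_zero_iff.1 he).symm
  rw [hm] at he
  obtain ⟨c, hc, hd⟩ := exists_adj_edist he
  refine ⟨c, hc, le_antisymm ?_ (tdist_adj k a hc)⟩
  rw [hm]
  exact Nat.succ_le_succ (tdist_le_iff.2 (Or.inr hd))

/-- A Bellman–Ford step in which the cap grows with the row. Row `0` is identically zero, so the
recursion can start from blank memory and needs no symbol for infinity. -/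
theorem eq_tdist_succ {k : ℕ} {G : SimpleGraph V} {a b : V} (hab : b ≠ a) {m : ℕ}
    (hk : m ≤ k + 1) (hle : ∀ c, G.Adj c b → m ≤ tdist k G a c + 1)
    (hex : m = k + 1 ∨ ∃ c, G.Adj c b ∧ m = tdist k G a c + 1) : m = tdist (k + 1) G a b := by
  apply le_antisymm
  · by_contra hlt
    push Not at hlt
    obtain ⟨c, hc, hcb⟩ := exists_adj_tdist hab (hlt.trans_le hk)
    have h1 := hle c hc
    have h2 : tdist k G a c ≤ tdist (k + 1) G a c := by
      rw [← ENat.natCast_le_natCast, coe_tdist, coe_tdist]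
      exact min_le_min_left _ (by simp)
    omega
  · rcases hex with rfl | ⟨c, hc, rfl⟩
    · exact tdist_le _ _ _ _
    · rw [tdist_le_iff]
      by_cases h : tdist k G a c < k
      · right
        rw [Nat.cast_add, ← edist_eq_of_tdist_lt h]
        refine SimpleGraph.edist_triangle.trans (add_le_add_right ?_ _)
        simp [SimpleGraph.edist_eq_one_iff_adj.2 hc]
      · left
        omega

theorem edist_lt_card [Fintype V] {G : SimpleGraph V} {a b : V} (h : G.edist a b ≠ ⊤) :
    G.edist a b < Fintype.card V := by
  classical
  obtain ⟨p⟩ := SimpleGraph.reachable_of_edist_ne_top h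
  refine (SimpleGraph.edist_le (p.toPath : G.Walk a b)).trans_lt ?_
  exact_mod_cast p.toPath.2.length_lt

/-- Finite distances are below the number of vertices, so the cap is attained only by unreachable
vertices. This keeps an equation `d u + 1 = d v` from holding spuriously with `d v` at the cap. -/
theorem tdist_lt_card_of_adj [Fintype V] {G : SimpleGraph V} {a b c : V} (h : G.Adj b c)
    (hb : tdist (Fintype.card V) G a b < Fintype.card V) :
    tdist (Fintype.card V) G a c < Fintype.card V := by
  have hne : G.edist a c ≠ ⊤ := by
    have h1 := edist_eq_of_tdist_lt hb
    rw [SimpleGraph.edist_ne_top_iff_reachable]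
    have : G.Reachable a b := by
      rw [← SimpleGraph.edist_ne_top_iff_reachable, h1]
      exact ENat.natCast_ne_top _
    exact this.trans h.reachable
  rw [← ENat.natCast_lt_natCast, coe_tdist]
  exact (min_le_left _ _).trans_lt (edist_lt_card hne)

theorem edist_eq_tdist_card [Fintype V] {G : SimpleGraph V} {a b : V} (h : G.edist a b ≠ ⊤) :
    G.edist a b = tdist (Fintype.card V) G a b := by
  rw [coe_tdist, min_eq_left (edist_lt_card h).le]

end TruncatedDistance
/-! ## Shortest path trees and replacement paths -/

section ReplacementPaths

variable {V : Type*} [Fintype V]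

/-- The distance in `G`, truncated at the number of vertices. -/
noncomputable abbrev cdist (G : SimpleGraph V) (a b : V) : ℕ := tdist (Fintype.card V) G a b

/-- The edge `uv` is the last edge of a shortest path from `s` to `v` after the failure of `e`. -/
def Sat (G : SimpleGraph V) (s : V) (e : Sym2 V) (u v : V) : Prop :=
  (G.deleteEdges {e}).Adj u v ∧
    cdist (G.deleteEdges {e}) s u + 1 = cdist (G.deleteEdges {e}) s v

/-- The function `p` assigns to every vertex its parent in a shortest path tree with root `s`. The
root and the vertices that are not reachable from `s` are fixed points of `p`. -/
structure IsParent (G : SimpleGraph V) (s : V) (p : V → V) : Prop where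
  root : p s = s
  adj : ∀ v, p v ≠ v → G.Adj (p v) v
  depth : ∀ v, p v ≠ v → cdist G s (p v) + 1 = cdist G s v
  reach : ∀ v, v ≠ s → cdist G s v < Fintype.card V → p v ≠ v

/-- The vertex `a` is an ancestor of `v` (or `v` itself). -/
def Anc {V : Type*} (p : V → V) (a v : V) : Prop := ∃ k, p^[k] v = a

theorem Anc.refl {V : Type*} (p : V → V) (v : V) : Anc p v v := ⟨0, rfl⟩

theorem Anc.parent {V : Type*} (p : V → V) (v : V) : Anc p (p v) v := ⟨1, rfl⟩

theorem Anc.trans {V : Type*} {p : V → V} {a b c : V} (h : Anc p a b) (h' : Anc p b c) :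
    Anc p a c := by
  obtain ⟨k, rfl⟩ := h
  obtain ⟨l, rfl⟩ := h'
  exact ⟨k + l, Function.iterate_add_apply p k l c⟩

theorem Anc.eq_or_parent {V : Type*} {p : V → V} {a v : V} (h : Anc p a v) :
    a = v ∨ Anc p a (p v) := by
  obtain ⟨k, rfl⟩ := h
  cases k with
  | zero => exact Or.inl rfl
  | succ k => exact Or.inr ⟨k, rfl⟩

theorem Anc.total {V : Type*} {p : V → V} {a b v : V} (ha : Anc p a v) (hb : Anc p b v) :
    Anc p a b ∨ Anc p b a := by
  obtain ⟨k, rfl⟩ := ha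
  obtain ⟨l, rfl⟩ := hb
  rcases le_total k l with h | h
  · right
    exact ⟨l - k, by rw [← Function.iterate_add_apply, Nat.sub_add_cancel h]⟩
  · left
    exact ⟨k - l, by rw [← Function.iterate_add_apply, Nat.sub_add_cancel h]⟩

variable {G : SimpleGraph V} {s : V} {p : V → V}

theorem Anc.ne_fixed {V : Type*} {p : V → V} {a v : V} (h : Anc p a v) (hne : a ≠ v) :
    p v ≠ v := by
  intro hv
  obtain ⟨k, rfl⟩ := h
  exact hne (Function.iterate_fixed hv k)

theorem IsParent.iterate_depth (hp : IsParent G s p) {x : V} (hx : p x ≠ x) :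
    ∀ (k : ℕ) (w : V), p^[k] w = x → cdist G s w = cdist G s x + k := by
  intro k
  induction k with
  | zero => rintro w rfl; rfl
  | succ k ih =>
    intro w hw
    have h1 := ih (p w) hw
    have h2 : p w ≠ w := by
      intro h
      have : p^[k + 1] w = w := Function.iterate_fixed h _
      rw [this] at hw
      exact hx (hw ▸ h)
    have h3 := hp.depth w h2
    omega

theorem IsParent.iterate_eq (hp : IsParent G s p) {x w : V} (hx : p x ≠ x) (h : Anc p x w) :
    p^[cdist G s w - cdist G s x] w = x := by
  obtain ⟨k, hk⟩ := h
  rw [hp.iterate_depth hx k w hk, Nat.add_sub_cancel_left, hk]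

theorem IsParent.depth_lt (hp : IsParent G s p) {a v : V} (h : Anc p a v) (hne : a ≠ v) :
    cdist G s a < cdist G s v := by
  obtain ⟨k, hk⟩ := h
  induction k generalizing v with
  | zero => exact absurd hk.symm hne
  | succ k ih =>
    have h2 : p v ≠ v := Anc.ne_fixed ⟨k + 1, hk⟩ hne
    have h3 := hp.depth v h2
    by_cases h4 : a = p v
    · subst h4; omega
    · have := ih h4 hk
      omega

theorem IsParent.depth_le (hp : IsParent G s p) {a v : V} (h : Anc p a v) :
    cdist G s a ≤ cdist G s v := by
  by_cases hne : a = v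
  · rw [hne]
  · exact (hp.depth_lt h hne).le

theorem IsParent.anc_root (hp : IsParent G s p) :
    ∀ (m : ℕ) (v : V), cdist G s v = m → m < Fintype.card V → Anc p s v := by
  intro m
  induction m with
  | zero =>
    intro v hv hm
    by_cases hs : v = s
    · exact hs ▸ Anc.refl p v
    · have := hp.depth v (hp.reach v hs (hv ▸ hm))
      omega
  | succ m ih =>
    intro v hv hm
    by_cases hs : v = s
    · exact hs ▸ Anc.refl p v
    · have := hp.depth v (hp.reach v hs (hv ▸ hm))
      exact (ih (p v) (by omega) (by omega)).trans (Anc.parent p v)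

/-- The graph after the failure of the edge from `x` to its parent. -/
abbrev cut {V : Type*} (G : SimpleGraph V) (p : V → V) (x : V) : SimpleGraph V :=
  G.deleteEdges {s(p x, x)}

theorem cut_le {V : Type*} (G : SimpleGraph V) (p : V → V) (x : V) : cut G p x ≤ G :=
  SimpleGraph.deleteEdges_le _

theorem cut_adj {V : Type*} {G : SimpleGraph V} {p : V → V} {x a b : V} :
    (cut G p x).Adj a b ↔ G.Adj a b ∧ s(a, b) ≠ s(p x, x) := by
  simp [cut, SimpleGraph.deleteEdges_adj]

theorem cut_adj_of_not_anc {V : Type*} {G : SimpleGraph V} {p : V → V} {x v a b : V}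
    (h : G.Adj a b) (hx : Anc p x v) (hb : ¬ Anc p b v) : (cut G p x).Adj a b := by
  refine cut_adj.2 ⟨h, fun he => ?_⟩
  rcases Sym2.eq_iff.1 he with ⟨-, rfl⟩ | ⟨-, rfl⟩
  · exact hb hx
  · exact hb ((Anc.parent p x).trans hx)

theorem IsParent.cut_adj_parent (hp : IsParent G s p) {x y : V} (hx : p x ≠ x) (hy : p y ≠ y)
    (hxy : y ≠ x) : (cut G p x).Adj (p y) y := by
  refine cut_adj.2 ⟨hp.adj y hy, fun he => ?_⟩
  rcases Sym2.eq_iff.1 he with ⟨-, h⟩ | ⟨h1, h2⟩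
  · exact hxy h
  · have h3 := hp.depth x hx
    have h4 := hp.depth y hy
    rw [h1, h2] at h4
    omega

theorem cdist_le_cut (p : V → V) (x v : V) : cdist G s v ≤ cdist (cut G p x) s v :=
  tdist_anti _ (cut_le G p x) _ _

/-- The tree path to `w` does not use the deleted edge. -/
theorem IsParent.cdist_cut_of_not_anc (hp : IsParent G s p) {x : V} (hx : p x ≠ x) :
    ∀ (m : ℕ) (w : V), cdist G s w = m → ¬ Anc p x w → cdist (cut G p x) s w = cdist G s w := by
  intro m
  induction m with
  | zero =>
    intro w hw hn
    refine le_antisymm ?_ (cdist_le_cut p x w)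
    by_cases hs : w = s
    · subst hs; rw [cdist, tdist_self]; exact Nat.zero_le _
    · by_cases hc : cdist G s w < Fintype.card V
      · have := hp.depth w (hp.reach w hs hc)
        omega
      · exact (tdist_le _ _ _ _).trans (not_lt.1 hc)
  | succ m ih =>
    intro w hw hn
    refine le_antisymm ?_ (cdist_le_cut p x w)
    by_cases hs : w = s
    · subst hs; rw [cdist, tdist_self]; exact Nat.zero_le _
    · by_cases hc : cdist G s w < Fintype.card V
      · have hne := hp.reach w hs hc
        have h1 := hp.depth w hne
        have h2 := ih (p w) (by omega) (fun h => hn (h.trans (Anc.parent p w)))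
        have h3 := tdist_adj (Fintype.card V) s
          (hp.cut_adj_parent hx hne (fun h => hn (h ▸ Anc.refl p w)))
        simp only [cdist] at *
        omega
      · exact (tdist_le _ _ _ _).trans (not_lt.1 hc)

theorem IsParent.cdist_cut_of_anc (hp : IsParent G s p) {x w : V} (hx : p x ≠ x)
    (hxw : Anc p x w) : ∀ (k : ℕ) (y : V), p^[k] y = w →
      cdist (cut G p x) s y ≤ cdist (cut G p x) s w + (cdist G s y - cdist G s w) := by
  intro k
  induction k with
  | zero => rintro y rfl; exact Nat.le_add_right _ _
  | succ k ih =>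
    intro y hy
    by_cases hyw : w = y
    · subst hyw; exact Nat.le_add_right _ _
    · have hne : p y ≠ y := Anc.ne_fixed ⟨k + 1, hy⟩ hyw
      have h1 := ih (p y) hy
      have h2 := hp.depth y hne
      have h3 : cdist G s w ≤ cdist G s (p y) := hp.depth_le ⟨k, hy⟩
      have h4 : y ≠ x := by
        rintro rfl
        have := hp.depth_le hxw
        omega
      have h5 := tdist_adj (Fintype.card V) s (hp.cut_adj_parent hx hne h4)
      simp only [cdist] at *
      omega

/-- After the failure of the edge from `x` to its parent, the edge `uv` ends a shortest path to `v`,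
but the edge from `v` to its parent does not. -/
structure Trigger (G : SimpleGraph V) (s : V) (p : V → V) (v x u : V) : Prop where
  ne : p x ≠ x
  sat : Sat G s s(p x, x) u v
  unsat : ¬ Sat G s s(p x, x) (p v) v

variable {v x u : V}

theorem Sat.lt_card {e : Sym2 V} (h : Sat G s e u v) :
    cdist (G.deleteEdges {e}) s v < Fintype.card V := by
  refine tdist_lt_card_of_adj h.1 ?_
  have h1 := h.2
  have h2 := tdist_le (Fintype.card V) (G.deleteEdges {e}) s v
  simp only [cdist] at *
  omega

theorem Sat.ne_root {e : Sym2 V} (h : Sat G s e u v) : v ≠ s := by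
  rintro rfl
  have h1 := h.2
  rw [cdist, cdist, tdist_self] at h1
  omega

/-- Otherwise the tree path to `v` survives and the parent edge of `v` would serve. -/
theorem Trigger.anc (hp : IsParent G s p) (h : Trigger G s p v x u) : Anc p x v := by
  by_contra hn
  have h1 := h.sat.lt_card
  have h2 := hp.cdist_cut_of_not_anc h.ne _ v rfl hn
  have h3 := hp.reach v h.sat.ne_root (by simp only [cut] at h2; omega)
  have h4 := hp.cdist_cut_of_not_anc h.ne _ (p v) rfl (fun h => hn (h.trans (Anc.parent p v)))
  have h5 := hp.depth v h3
  exact h.unsat ⟨hp.cut_adj_parent h.ne h3 (fun h => hn (h ▸ Anc.refl p v)), by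
    simp only [cut] at *; omega⟩

theorem Trigger.anc_root (hp : IsParent G s p) (h : Trigger G s p v x u) : Anc p s v :=
  hp.anc_root _ v rfl ((cdist_le_cut p x v).trans_lt h.sat.lt_card)

/-- A shortest replacement path through `w` could continue along the tree path from `w` to `v`,
which is intact, and would then end with the parent edge of `v`. -/
theorem Trigger.lt_of_anc (hp : IsParent G s p) (h : Trigger G s p v x u) {w : V}
    (hxw : Anc p x w) (hwv : Anc p w v) (hne : w ≠ v) :
    cdist (cut G p x) s v < cdist (cut G p x) s w + (cdist G s v - cdist G s w) := by
  by_contra hlt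
  have hpv : p v ≠ v := hwv.ne_fixed hne
  have hw : Anc p w (p v) := hwv.eq_or_parent.resolve_left hne
  obtain ⟨k, hk⟩ := hw
  have h1 := hp.cdist_cut_of_anc h.ne hxw k _ hk
  have h2 := hp.depth v hpv
  have h3 := hp.depth_le ⟨k, hk⟩
  have h4 : v ≠ x := by
    rintro rfl
    have := hp.depth_le hxw
    omega
  have h5 := hp.cut_adj_parent h.ne hpv h4
  have h6 := tdist_adj (Fintype.card V) s h5
  refine h.unsat ⟨h5, ?_⟩
  simp only [cdist, cut] at *
  omega

/-- At or below `x` this is excluded by `Trigger.lt_of_anc`. Above `x`, the vertex `u` keeps its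
depth, so a step from it to `v` can end a shortest path only if `u = p v`. -/
theorem Trigger.not_anc (hp : IsParent G s p) (h : Trigger G s p v x u) : ¬ Anc p u v := by
  intro huv
  have h1 := h.sat.2
  have hne : u ≠ v := by rintro rfl; omega
  have hadj : G.Adj u v := cut_le G p x h.sat.1
  by_cases hxu : Anc p x u
  · have h2 := h.lt_of_anc hp hxu huv hne
    have h3 := tdist_adj (Fintype.card V) s hadj
    simp only [cdist, cut] at *
    omega
  · have h2 := hp.cdist_cut_of_not_anc h.ne _ u rfl hxu
    have h3 := cdist_le_cut (G := G) (s := s) p x v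
    have h4 : Anc p u (p v) := huv.eq_or_parent.resolve_left hne
    have h5 := hp.depth v (huv.ne_fixed hne)
    by_cases h6 : u = p v
    · exact h.unsat (h6 ▸ h.sat)
    · have h7 := hp.depth_lt h4 h6
      simp only [cdist, cut] at *
      omega

/-- The subgraph of `G` without the ancestors of `v`. -/
def offPath {V : Type*} (G : SimpleGraph V) (p : V → V) (v : V) : SimpleGraph V where
  Adj a b := G.Adj a b ∧ ¬ Anc p a v ∧ ¬ Anc p b v
  symm := ⟨fun _ _ h => ⟨h.1.symm, h.2.2, h.2.1⟩⟩
  loopless := ⟨fun _ h => h.1.ne rfl⟩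

theorem offPath_le {V : Type*} (G : SimpleGraph V) (p : V → V) (v : V) : offPath G p v ≤ G :=
  fun _ _ h => h.1

theorem offPath_le_cut {V : Type*} {G : SimpleGraph V} {p : V → V} {v x : V} (hx : Anc p x v) :
    offPath G p v ≤ cut G p x :=
  fun _ _ h => cut_adj_of_not_anc h.1 hx h.2.2

/-- The vertices on detours that avoid the ancestors of `v` and lead to `v` through `u`, after the
failure of the edge from `x` to its parent. -/
def detour (G : SimpleGraph V) (s : V) (p : V → V) (v x u : V) : Set V :=
  {w | ¬ Anc p w v ∧
    cdist (cut G p x) s w + cdist (offPath G p v) w u ≤ cdist (cut G p x) s u}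

theorem Trigger.mem_detour (hp : IsParent G s p) (h : Trigger G s p v x u) :
    u ∈ detour G s p v x u :=
  ⟨h.not_anc hp, by rw [cdist, cdist, tdist_self]; exact le_rfl⟩

/-- The tails from `w` to `u` and from `w` to `t` avoid the tree path to `v`, so either may be used
after either failure. Minimality for `x` and for `y` forces equal lengths. By symmetry each last
edge then serves for the other failure, which a family forbids: detours are disjoint. -/
theorem sat_of_mem_detour (hp : IsParent G s p) {y t w : V} (hx : Trigger G s p v x u)
    (hy : Trigger G s p v y t) (hwx : w ∈ detour G s p v x u) (hwy : w ∈ detour G s p v y t) :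
    Sat G s s(p y, y) u v := by
  have h1 : (cut G p x).Adj t v :=
    (cut_adj_of_not_anc (SimpleGraph.Adj.symm (cut_le G p y hy.sat.1)) (hx.anc hp)
      (hy.not_anc hp)).symm
  have h2 : (cut G p y).Adj u v :=
    (cut_adj_of_not_anc (SimpleGraph.Adj.symm (cut_le G p x hx.sat.1)) (hy.anc hp)
      (hx.not_anc hp)).symm
  refine ⟨h2, ?_⟩
  have a1 := tdist_adj (Fintype.card V) s h1
  have a2 := tdist_adj (Fintype.card V) s h2
  have a3 := tdist_triangle (Fintype.card V) (cut G p x) s w t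
  have a4 := tdist_triangle (Fintype.card V) (cut G p y) s w u
  have a5 := tdist_anti (Fintype.card V) (offPath_le_cut (G := G) (hx.anc hp)) w t
  have a6 := tdist_anti (Fintype.card V) (offPath_le_cut (G := G) (hy.anc hp)) w u
  have a7 := hwx.2
  have a8 := hwy.2
  have a9 := hx.sat.2
  have a10 := hy.sat.2
  simp only [cdist, cut] at *
  omega

/-- Walk back from `w` along a shortest path until it meets an ancestor `b` of `v`. The last clause
holds because this route consists of the tree path to `b` and edges off the tree path to `v`, so it
survives the failure of any edge of that path below `b`. -/
theorem Trigger.exists_branch (hp : IsParent G s p) (h : Trigger G s p v x u) :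
    ∀ (m : ℕ) (w : V), cdist (cut G p x) s w = m → w ∈ detour G s p v x u →
      ∃ b, Anc p b v ∧ ¬ Anc p x b ∧ Anc p b w ∧
        (∀ i, cdist G s b < i → i ≤ m →
          ∃ y ∈ detour G s p v x u, Anc p b y ∧ cdist (cut G p x) s y = i) ∧
        ∀ z, p z ≠ z → Anc p z v → ¬ Anc p z b → cdist (cut G p z) s w ≤ m := by
  intro m
  induction m with
  | zero =>
    intro w hw hdet
    have h0 : w = s := by
      by_contra hs
      obtain ⟨c, -, hc⟩ := exists_adj_tdist (k := Fintype.card V) (G := cut G p x) hs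
        (by rw [cdist] at hw; rw [hw]; exact Fintype.card_pos_iff.2 ⟨s⟩)
      rw [cdist] at hw
      omega
    exact absurd (h.anc_root hp) (h0 ▸ hdet.1)
  | succ m ih =>
    intro w hw hdet
    have hws : w ≠ s := fun h0 => hdet.1 (h0 ▸ h.anc_root hp)
    have hlt : cdist (cut G p x) s w < Fintype.card V := by
      have h1 := h.sat.lt_card
      have h2 := h.sat.2
      have h3 := hdet.2
      simp only [cut] at *
      omega
    -- Outside the subtree of `x` the predecessor is taken to be the tree parent, which keeps `w`
    -- below `b`. Inside it any predecessor will do, because `b` is above `x`.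
    obtain ⟨w', hadj, hd, hor⟩ : ∃ w', (cut G p x).Adj w' w ∧
        cdist (cut G p x) s w' + 1 = cdist (cut G p x) s w ∧ (Anc p x w ∨ w' = p w) := by
      by_cases hxw : Anc p x w
      · obtain ⟨c, hc, hc'⟩ := exists_adj_tdist hws hlt
        exact ⟨c, hc, hc', Or.inl hxw⟩
      · have h1 := hp.cdist_cut_of_not_anc h.ne _ w rfl hxw
        have h2 := hp.reach w hws (h1 ▸ hlt)
        have h3 := hp.cdist_cut_of_not_anc h.ne _ (p w) rfl
          (fun h => hxw (h.trans (Anc.parent p w)))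
        exact ⟨p w, hp.cut_adj_parent h.ne h2 (fun h => hxw (h ▸ Anc.refl p w)),
          by rw [h1, h3, hp.depth w h2], Or.inr rfl⟩
    have hancw : ∀ b, Anc p b v → ¬ Anc p x b → Anc p b w' → Anc p b w := by
      intro b hb hxb hbw
      rcases hor with hor | rfl
      · exact (((h.anc hp).total hb).resolve_left hxb).trans hor
      · exact hbw.trans (Anc.parent p w)
    have hcut : ∀ z, Anc p z v → cdist (cut G p z) s w ≤ cdist (cut G p z) s w' + 1 := by
      intro z hz
      exact tdist_adj _ s (cut_adj_of_not_anc (cut_le G p x hadj) hz hdet.1)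
    by_cases hw'v : Anc p w' v
    · have hnx : ¬ Anc p x w' := by
        intro hxw'
        have hsat := h.sat.2
        have hd2 := hdet.2
        have hne : w' ≠ v := by
          rintro rfl
          simp only [cut] at *
          omega
        have h1 := h.lt_of_anc hp hxw' hw'v hne
        have h2 := tdist_adj (Fintype.card V) s (cut_le G p x h.sat.1)
        have h3 := tdist_triangle (Fintype.card V) G s w u
        have h4 := tdist_adj (Fintype.card V) s (cut_le G p x hadj)
        have h5 := tdist_anti (Fintype.card V) (offPath_le G p v) w u
        simp only [cdist, cut] at *
        omega
      have hbd := hp.cdist_cut_of_not_anc h.ne _ w' rfl hnx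
      refine ⟨w', hw'v, hnx, ?_, ?_, ?_⟩
      · exact hancw w' hw'v hnx (Anc.refl p w')
      · intro i hi1 hi2
        exact ⟨w, hdet, hancw w' hw'v hnx (Anc.refl p w'), by omega⟩
      · intro z hz hzv hzb
        have h1 := hp.cdist_cut_of_not_anc hz _ w' rfl hzb
        have h2 := hcut z hzv
        omega
    · have hdet' : w' ∈ detour G s p v x u := by
        refine ⟨hw'v, ?_⟩
        have h1 : (offPath G p v).Adj w' w := ⟨cut_le G p x hadj, hw'v, hdet.1⟩
        have h2 := tdist_triangle (Fintype.card V) (offPath G p v) w' w u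
        have h3 := tdist_le_one (Fintype.card V) h1
        have h4 := hdet.2
        simp only [cdist, cut] at *
        omega
      obtain ⟨b, hb1, hb2, hb3, hb4, hb5⟩ := ih w' (by omega) hdet'
      refine ⟨b, hb1, hb2, hancw b hb1 hb2 hb3, ?_, ?_⟩
      · intro i hi1 hi2
        by_cases him : i ≤ m
        · exact hb4 i hi1 him
        · exact ⟨w, hdet, hancw b hb1 hb2 hb3, by omega⟩
      · intro z hz hzv hzb
        have h1 := hb5 z hz hzv hzb
        have h2 := hcut z hzv
        omega

/-- The first part makes detours long, the second confines their lower part to the subtree of any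
competing trigger `z` above `x`. -/
theorem Trigger.exists_anc_branch (hp : IsParent G s p) (h : Trigger G s p v x u) :
    ∃ b, Anc p b x ∧ b ≠ x ∧
      (∀ i, cdist G s b < i → i < cdist (cut G p x) s v →
        ∃ y ∈ detour G s p v x u, Anc p b y ∧ cdist (cut G p x) s y = i) ∧
      ∀ z t, Trigger G s p v z t → Anc p z x → z ≠ x →
        (¬ Sat G s s(p z, z) u v ∨ ¬ Sat G s s(p x, x) t v) → Anc p z b := by
  obtain ⟨b, hb1, hb2, hb3, hb4, hb5⟩ := h.exists_branch hp _ u rfl (h.mem_detour hp)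
  have hbx : Anc p b x := ((h.anc hp).total hb1).resolve_left hb2
  refine ⟨b, hbx, fun he => hb2 (he ▸ Anc.refl p b), fun i hi1 hi2 => hb4 i hi1 ?_, ?_⟩
  · have := h.sat.2
    simp only [cut] at *
    omega
  · intro z t hz hzx hne hor
    by_contra hzb
    obtain ⟨b', hb1', hb2', hb3', hb4', hb5'⟩ := hz.exists_branch hp _ t rfl (hz.mem_detour hp)
    -- If `b` is above the edge at `z`, the route for `x` avoids that edge; the route for `z`, which
    -- branches off above `z`, avoids the edge at `x`. Hence `v` has the same distance after both
    -- failures, and both last edges serve for both.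
    have h1 := hb5 z hz.ne (hz.anc hp) hzb
    have h2 := hb5' x h.ne (h.anc hp) (fun hx => hb2' (hzx.trans hx))
    have a1 : (cut G p x).Adj t v :=
      (cut_adj_of_not_anc (SimpleGraph.Adj.symm (cut_le G p z hz.sat.1)) (h.anc hp)
        (hz.not_anc hp)).symm
    have a2 : (cut G p z).Adj u v :=
      (cut_adj_of_not_anc (SimpleGraph.Adj.symm (cut_le G p x h.sat.1)) (hz.anc hp)
        (h.not_anc hp)).symm
    have c1 := tdist_adj (Fintype.card V) s a1
    have c2 := tdist_adj (Fintype.card V) s a2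
    have c3 := h.sat.2
    have c4 := hz.sat.2
    simp only [cdist, cut] at *
    rcases hor with hor | hor
    · exact hor ⟨a2, by simp only [cdist]; omega⟩
    · exact hor ⟨a1, by simp only [cdist]; omega⟩

end ReplacementPaths
/-! ## Counting the last edges of replacement paths -/

section Counting

variable {V : Type*} [Fintype V] {G : SimpleGraph V} {s : V} {p : V → V} {v : V}
  {X : Finset V} {u : V → V}

/-- A set `X` of triggers with last edges `(u x, v)` such that, for any two elements `x` and `y`
of `X`, the last edge of `x` does not serve for `y`, or that of `y` does not serve for `x`. -/
structure TriggerFamily (G : SimpleGraph V) (s : V) (p : V → V) (v : V) (X : Finset V)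
    (u : V → V) : Prop where
  trigger : ∀ x ∈ X, Trigger G s p v x (u x)
  pair : ∀ x ∈ X, ∀ y ∈ X, x ≠ y →
    ¬ Sat G s s(p y, y) (u x) v ∨ ¬ Sat G s s(p x, x) (u y) v

/-- Packing: the detours are disjoint, and each meets `A` in at least `l` vertices, one for each of
`l` distances. -/
theorem TriggerFamily.card_mul_le (hp : IsParent G s p) (h : TriggerFamily G s p v X u)
    {Y A : Finset V} (hY : Y ⊆ X) (l : ℕ)
    (hA : ∀ x ∈ Y, ∃ d, ∀ i, d < i → i ≤ d + l →
      ∃ y ∈ detour G s p v x (u x), y ∈ A ∧ cdist (cut G p x) s y = i) :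
    Y.card * l ≤ A.card := by
  classical
  have hcard : ∀ x ∈ Y, l ≤ (A.filter (· ∈ detour G s p v x (u x))).card := by
    intro x hx
    obtain ⟨d, hd⟩ := hA x hx
    have h1 : (Finset.Ioc d (d + l)).card ≤
        (A.filter (· ∈ detour G s p v x (u x))).card := by
      refine Finset.card_le_card_of_surjOn (fun y => cdist (cut G p x) s y) ?_
      intro i hi
      have hi' := Finset.mem_Ioc.1 (Finset.mem_coe.1 hi)
      obtain ⟨y, hy1, hy2, hy3⟩ := hd i hi'.1 hi'.2
      exact ⟨y, Finset.mem_coe.2 (Finset.mem_filter.2 ⟨hy2, hy1⟩), hy3⟩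
    simpa using h1
  calc Y.card * l ≤ ∑ x ∈ Y, (A.filter (· ∈ detour G s p v x (u x))).card := by
        simpa using Finset.card_nsmul_le_sum Y _ l hcard
    _ = (Y.biUnion fun x => A.filter (· ∈ detour G s p v x (u x))).card := by
        refine (Finset.card_biUnion ?_).symm
        intro x hx y hy hxy
        rw [Function.onFun, Finset.disjoint_left]
        intro w hw1 hw2
        have m1 := (Finset.mem_filter.1 hw1).2
        have m2 := (Finset.mem_filter.1 hw2).2
        have t1 := h.trigger x (hY hx)
        have t2 := h.trigger y (hY hy)
        rcases h.pair x (hY hx) y (hY hy) hxy with hn | hn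
        · exact hn (sat_of_mem_detour hp t1 t2 m1 m2)
        · exact hn (sat_of_mem_detour hp t2 t1 m2 m1)
    _ ≤ A.card := Finset.card_le_card (Finset.biUnion_subset.2 fun x _ => Finset.filter_subset _ _)

theorem IsParent.eq_of_anc_of_depth (hp : IsParent G s p) {x y : V} (hx : Anc p x v)
    (hy : Anc p y v) (h : cdist G s x = cdist G s y) : x = y := by
  by_contra hne
  rcases hx.total hy with h1 | h1
  · exact absurd (hp.depth_lt h1 hne) (by omega)
  · exact absurd (hp.depth_lt h1 (Ne.symm hne)) (by omega)

/-- At most `t` members are less than `t` levels above `v`, as an ancestor is determined by its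
depth. The other members have disjoint detours of at least `t` vertices, and `t * t` exceeds the
number of vertices. -/
theorem TriggerFamily.card_le_sqrt (hp : IsParent G s p) (h : TriggerFamily G s p v X u) :
    X.card ≤ 2 * Nat.sqrt (Fintype.card V) + 1 := by
  classical
  set t := Nat.sqrt (Fintype.card V) + 1 with ht
  rw [← Finset.card_filter_add_card_filter_not (s := X)
    (fun x => cdist G s v - cdist G s x < t)]
  have h1 : (X.filter fun x => cdist G s v - cdist G s x < t).card ≤ t := by
    have : (X.filter fun x => cdist G s v - cdist G s x < t).card ≤ (Finset.range t).card := by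
      refine Finset.card_le_card_of_injOn (fun x => cdist G s v - cdist G s x) ?_ ?_
      · intro x hx
        simpa using (Finset.mem_filter.1 (Finset.mem_coe.1 hx)).2
      · intro x hx y hy hxy
        have ax := (h.trigger x (Finset.mem_filter.1 (Finset.mem_coe.1 hx)).1).anc hp
        have ay := (h.trigger y (Finset.mem_filter.1 (Finset.mem_coe.1 hy)).1).anc hp
        have dx := hp.depth_le ax
        have dy := hp.depth_le ay
        exact hp.eq_of_anc_of_depth ax ay (by simp only at hxy; omega)
    simpa using this
  have h2 : (X.filter fun x => ¬ cdist G s v - cdist G s x < t).card * t ≤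
      (Finset.univ : Finset V).card := by
    refine h.card_mul_le hp (Finset.filter_subset _ _) t ?_
    intro x hx
    obtain ⟨hxX, hxt⟩ := Finset.mem_filter.1 hx
    obtain ⟨b, hb1, hb2, hb3, -⟩ := (h.trigger x hxX).exists_anc_branch hp
    -- The `t` values after the depth of `b` stay below the new distance of `v`, since `b` is
    -- strictly above `x` and `x` is at least `t` levels above `v`.
    refine ⟨cdist G s b, fun i hi1 hi2 => ?_⟩
    have d1 := hp.depth_lt hb1 hb2
    have d2 := cdist_le_cut (G := G) (s := s) p x v
    obtain ⟨y, hy1, -, hy3⟩ := hb3 i hi1 (by omega)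
    exact ⟨y, hy1, Finset.mem_univ _, hy3⟩
  have h3 : Fintype.card V < t * t := Nat.lt_succ_sqrt _
  rw [Finset.card_univ] at h2
  have h4 : (X.filter fun x => ¬ cdist G s v - cdist G s x < t).card < t := by
    by_contra hlt
    have := Nat.mul_le_mul_right t (not_lt.1 hlt)
    omega
  omega

/-- The subtree below `x` has, for some `L`, at least `K * (L + 1)` vertices at distance at most `L`
from `x`. -/
def Dense (p : V → V) (K : ℕ) (x : V) : Prop :=
  ∃ L < Fintype.card V, K * (L + 1) ≤ ∑ j ∈ Finset.range (L + 1), {w | p^[j] w = x}.ncard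

theorem IsParent.card_lt_of_not_dense (hp : IsParent G s p) {x : V} (hx : p x ≠ x) {K : ℕ}
    (h : ¬ Dense p K x) {A : Finset V} {L : ℕ}
    (hA : ∀ w ∈ A, Anc p x w ∧ cdist G s w ≤ cdist G s x + L) : A.card < K * (L + 1) := by
  classical
  have key : ∀ L' < Fintype.card V, (∀ w ∈ A, cdist G s w ≤ cdist G s x + L') →
      A.card < K * (L' + 1) := by
    intro L' hL' hA'
    have h1 := fun hle => h ⟨L', hL', hle⟩
    refine lt_of_le_of_lt ?_ (not_le.1 h1)
    have h2 : A ⊆ (Finset.range (L' + 1)).biUnion fun j =>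
        {w | p^[j] w = x}.toFinite.toFinset := by
      intro w hw
      refine Finset.mem_biUnion.2 ⟨cdist G s w - cdist G s x, ?_, ?_⟩
      · have := hA' w hw
        exact Finset.mem_range.2 (by omega)
      · simpa using hp.iterate_eq hx (hA w hw).1
    refine (Finset.card_le_card h2).trans (Finset.card_biUnion_le.trans ?_)
    refine Finset.sum_le_sum fun j _ => ?_
    rw [Set.ncard_eq_toFinset_card _ (Set.toFinite _)]
  by_cases hL : L < Fintype.card V
  · exact key L hL fun w hw => (hA w hw).2
  -- Since `x` has depth at least one, relative depths are at most `Fintype.card V - 1`, the largest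
  -- radius that `Dense` allows.
  · have h0 : 0 < Fintype.card V := Fintype.card_pos_iff.2 ⟨x⟩
    have hd := hp.depth x hx
    have h1 := key (Fintype.card V - 1) (by omega) fun w hw => by
      have := tdist_le (Fintype.card V) G s w
      simp only [cdist] at *
      omega
    refine h1.trans_le (Nat.mul_le_mul_left K (by omega))

/-- Let `z` be the topmost element of `Y`. Every other element has `l` detour vertices below its
branch vertex, hence below `z`. Their depths are less than that of `v`, so at most `2 * l - 1`
relative to `z`. Non-density of `z` leaves room for fewer than `2 * K` such detours, and `z` itself
makes at most `2 * K`. -/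
theorem TriggerFamily.card_scale_le (hp : IsParent G s p) (h : TriggerFamily G s p v X u)
    {K l : ℕ} (hl : 0 < l) {Y : Finset V} (hYX : Y ⊆ X)
    (hY : ∀ x ∈ Y, ¬ Dense p K x ∧ l ≤ cdist G s v - cdist G s x ∧
      cdist G s v - cdist G s x < 2 * l) : Y.card ≤ 2 * K := by
  classical
  rcases Y.eq_empty_or_nonempty with rfl | hne
  · simp
  obtain ⟨z, hz, hmin⟩ := Y.exists_min_image (fun x => cdist G s x) hne
  have tz := h.trigger z (hYX hz)
  have az := tz.anc hp
  set A : Finset V := Finset.univ.filter fun w =>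
    Anc p z w ∧ cdist G s w ≤ cdist G s z + (2 * l - 1) with hAdef
  have h1 : A.card < K * (2 * l - 1 + 1) :=
    hp.card_lt_of_not_dense tz.ne (hY z hz).1 fun w hw => (Finset.mem_filter.1 hw).2
  have h2 : (Y.erase z).card * l ≤ A.card := by
    refine h.card_mul_le hp ((Finset.erase_subset _ _).trans hYX) l ?_
    intro x hx
    obtain ⟨hxz, hxY⟩ := Finset.mem_erase.1 hx
    have tx := h.trigger x (hYX hxY)
    have ax := tx.anc hp
    have hzx : Anc p z x := by
      rcases az.total ax with h3 | h3
      · exact h3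
      · exact absurd (hp.depth_lt h3 hxz) (not_lt.2 (hmin x hxY))
    obtain ⟨b, hb1, hb2, hb3, hb4⟩ := tx.exists_anc_branch hp
    have hzb := hb4 z (u z) tz hzx (Ne.symm hxz) (h.pair x (hYX hxY) z (hYX hz) hxz)
    refine ⟨cdist G s b, fun i hi1 hi2 => ?_⟩
    have d1 := hp.depth_lt hb1 hb2
    have d2 := cdist_le_cut (G := G) (s := s) p x v
    have d3 := (hY x hxY).2
    have d4 := (hY z hz).2
    obtain ⟨y, hy1, hy2, hy3⟩ := hb3 i hi1 (by omega)
    have d5 := cdist_le_cut (G := G) (s := s) p x y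
    exact ⟨y, hy1, Finset.mem_filter.2 ⟨Finset.mem_univ _, hzb.trans hy2, by omega⟩, hy3⟩
  rw [Finset.card_erase_of_mem hz] at h2
  have h3 : (Y.card - 1) * l < (2 * K) * l := by
    refine lt_of_le_of_lt h2 (h1.trans_eq ?_)
    rw [Nat.sub_add_cancel (by omega)]
    ring
  have := Nat.lt_of_mul_lt_mul_right h3
  omega

/-- Split by the binary logarithm of the height above `v`. Height zero, possible only for `v`
itself, accounts for the final `+ 1`. -/
theorem TriggerFamily.card_le_log (hp : IsParent G s p) (h : TriggerFamily G s p v X u) {K : ℕ}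
    (hX : ∀ x ∈ X, ¬ Dense p K x) :
    X.card ≤ (Nat.log 2 (Fintype.card V) + 1) * (2 * K) + 1 := by
  classical
  set f : V → ℕ := fun x => cdist G s v - cdist G s x with hf
  have hsplit := Finset.card_filter_add_card_filter_not (s := X) (fun x => f x = 0)
  have h1 : (X.filter fun x => f x = 0).card ≤ 1 := by
    refine Finset.card_le_one.2 fun x hx y hy => ?_
    have ax := (h.trigger x (Finset.mem_filter.1 hx).1).anc hp
    have ay := (h.trigger y (Finset.mem_filter.1 hy).1).anc hp
    have dx := hp.depth_le ax
    have dy := hp.depth_le ay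
    have e1 := (Finset.mem_filter.1 hx).2
    have e2 := (Finset.mem_filter.1 hy).2
    simp only [hf] at e1 e2
    exact hp.eq_of_anc_of_depth ax ay (by omega)
  have h2 : (X.filter fun x => ¬ f x = 0).card ≤
      2 * K * (Finset.range (Nat.log 2 (Fintype.card V) + 1)).card := by
    refine Finset.card_le_mul_card_image_of_maps_to (f := fun x => Nat.log 2 (f x)) ?_ _ ?_
    · intro x _
      refine Finset.mem_range.2 (Nat.lt_succ_of_le (Nat.log_mono_right ?_))
      exact (Nat.sub_le _ _).trans (tdist_le _ _ _ _)
    · intro t _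
      refine h.card_scale_le hp (l := 2 ^ t) (by positivity)
        ((Finset.filter_subset _ _).trans (Finset.filter_subset _ _)) ?_
      intro x hx
      obtain ⟨hx1, hx2⟩ := Finset.mem_filter.1 hx
      obtain ⟨hx3, hx4⟩ := Finset.mem_filter.1 hx1
      refine ⟨hX x hx3, ?_, ?_⟩
      · rw [← hx2]; exact Nat.pow_log_le_self 2 hx4
      · have := Nat.lt_pow_succ_log_self (b := 2) (by norm_num) (f x)
        rw [hx2, pow_succ] at this
        simp only [hf] at this
        omega
  rw [Finset.card_range, mul_comm] at h2
  omega

/-- Each `w` pays `1 / (K * (j + 1))` to `p^[j] w` for every `j`, in total the harmonic number over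
`K`. A dense vertex with radius `L` receives at least `1`, since each of the `K * (L + 1)` payments
counted within that radius is at least `1 / (K * (L + 1))`. -/
theorem card_dense_le (p : V → V) {K : ℕ} (hK : 0 < K) :
    ({x | Dense p K x}.ncard : ℝ) ≤ Fintype.card V * (harmonic (Fintype.card V) : ℝ) / K := by
  classical
  have hK' : (0 : ℝ) < K := Nat.cast_pos.2 hK
  set N := Fintype.card V with hN
  set D := {x | Dense p K x}.toFinite.toFinset with hD
  have hone : ∀ x ∈ D, (1 : ℝ) ≤ ∑ w : V, ∑ j ∈ Finset.range N,
      if p^[j] w = x then 1 / (K * ((j : ℝ) + 1)) else 0 := by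
    intro x hx
    obtain ⟨L, hL, hle⟩ : Dense p K x := by simpa [hD] using hx
    have hpos : (0 : ℝ) < K * ((L : ℝ) + 1) := by positivity
    have hle' : (K * ((L : ℝ) + 1)) ≤
        ∑ j ∈ Finset.range (L + 1), ({w | p^[j] w = x}.ncard : ℝ) := by exact_mod_cast hle
    calc (1 : ℝ) ≤ (∑ j ∈ Finset.range (L + 1), ({w | p^[j] w = x}.ncard : ℝ)) /
          (K * ((L : ℝ) + 1)) := by rwa [le_div_iff₀ hpos, one_mul]
      _ = ∑ j ∈ Finset.range (L + 1), ∑ w : V,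
          if p^[j] w = x then 1 / (K * ((L : ℝ) + 1)) else 0 := by
        rw [Finset.sum_div]
        refine Finset.sum_congr rfl fun j _ => ?_
        rw [← Finset.sum_filter, Finset.sum_const, nsmul_eq_mul, mul_one_div]
        congr 2
        rw [Set.ncard_eq_toFinset_card _ (Set.toFinite _)]
        congr 1
        ext w
        simp
      _ ≤ ∑ j ∈ Finset.range (L + 1), ∑ w : V,
          if p^[j] w = x then 1 / (K * ((j : ℝ) + 1)) else 0 := by
        refine Finset.sum_le_sum fun j hj => Finset.sum_le_sum fun w _ => ?_
        split_ifs
        · have hjL : (j : ℝ) ≤ L := by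
            exact_mod_cast Nat.lt_succ_iff.1 (Finset.mem_range.1 hj)
          exact one_div_le_one_div_of_le (by positivity)
            (mul_le_mul_of_nonneg_left (by linarith) hK'.le)
        · exact le_rfl
      _ ≤ ∑ j ∈ Finset.range N, ∑ w : V,
          if p^[j] w = x then 1 / (K * ((j : ℝ) + 1)) else 0 := by
        refine Finset.sum_le_sum_of_subset_of_nonneg (Finset.range_mono hL) fun j _ _ =>
          Finset.sum_nonneg fun w _ => ?_
        split_ifs <;> positivity
      _ = _ := Finset.sum_comm
  rw [Set.ncard_eq_toFinset_card _ (Set.toFinite _)]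
  calc (D.card : ℝ) = ∑ x ∈ D, (1 : ℝ) := by simp
    _ ≤ ∑ x ∈ D, ∑ w : V, ∑ j ∈ Finset.range N,
        (if p^[j] w = x then 1 / (K * ((j : ℝ) + 1)) else 0) := Finset.sum_le_sum hone
    _ = ∑ w : V, ∑ j ∈ Finset.range N, ∑ x ∈ D,
        (if p^[j] w = x then 1 / (K * ((j : ℝ) + 1)) else 0) := by
        rw [Finset.sum_comm]
        exact Finset.sum_congr rfl fun w _ => Finset.sum_comm
    _ ≤ ∑ w : V, ∑ j ∈ Finset.range N, 1 / (K * ((j : ℝ) + 1)) := by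
        refine Finset.sum_le_sum fun w _ => Finset.sum_le_sum fun j _ => ?_
        rw [Finset.sum_ite_eq]
        split_ifs
        · exact le_rfl
        · positivity
    _ = N * (harmonic N : ℝ) / K := by
        rw [Finset.sum_const, Finset.card_univ, nsmul_eq_mul, mul_div_assoc]
        congr 1
        rw [harmonic, Rat.cast_sum, Finset.sum_div]
        refine Finset.sum_congr rfl fun j _ => ?_
        push_cast
        field_simp

end Counting
/-! ## Collections of last edges -/

section Collections

variable {V : Type*} [Fintype V] {G : SimpleGraph V} {s : V} {p : V → V}

/-- The edges in `H` are those in `H₀` and at most one last edge for each element of certain trigger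
families, which do not contain dense vertices. -/
def Certified (G : SimpleGraph V) (s : V) (p : V → V) (K : ℕ) (H₀ H : Set (Sym2 V)) : Prop :=
  H ⊆ G.edgeSet ∧ H₀ ⊆ H ∧ ∃ (X : V → Finset V) (u : V → V → V),
    H.ncard ≤ H₀.ncard + ∑ v, (X v).card ∧
    ∀ v, TriggerFamily G s p v (X v) (u v) ∧ ∀ x ∈ X v, ¬ Dense p K x ∧ s(u v x, v) ∈ H

theorem Certified.refl {K : ℕ} {H₀ : Set (Sym2 V)} (h : H₀ ⊆ G.edgeSet) :
    Certified G s p K H₀ H₀ :=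
  ⟨h, subset_rfl, fun _ => ∅, fun _ _ => s, by simp, fun _ => ⟨⟨by simp, by simp⟩, by simp⟩⟩

/-- The new edge is charged to `x` at `v`. No edge of `H` serves, in particular not the parent edge
of `v`, so `x` is a trigger, and it has not been charged at `v` before. -/
theorem Certified.insert {K : ℕ} {H₀ H : Set (Sym2 V)} (h : Certified G s p K H₀ H)
    (hH₀ : ∀ v, p v ≠ v → s(p v, v) ∈ H₀) {x c v : V} (hx : p x ≠ x) (hxK : ¬ Dense p K x)
    (hc : Sat G s s(p x, x) c v) (hH : ∀ u, Sat G s s(p x, x) u v → s(u, v) ∉ H) :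
    Certified G s p K H₀ (insert s(c, v) H) := by
  classical
  obtain ⟨h1, h2, X, u, h3, h4⟩ := h
  have hcv : s(c, v) ∈ G.edgeSet := SimpleGraph.deleteEdges_le _ hc.1
  have hxX : x ∉ X v := fun hxv =>
    hH _ ((h4 v).1.trigger x hxv).sat ((h4 v).2 x hxv).2
  have htrig : Trigger G s p v x c := by
    refine ⟨hx, hc, fun hs => hH _ hs (h2 (hH₀ v ?_))⟩
    exact (SimpleGraph.deleteEdges_le _ hs.1 : G.Adj (p v) v).ne
  refine ⟨Set.insert_subset hcv h1, h2.trans (Set.subset_insert _ _),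
    Function.update X v (Insert.insert x (X v)),
    Function.update u v (Function.update (u v) x c), ?_, fun w => ?_⟩
  · refine (Set.ncard_insert_le _ _).trans ?_
    have : ∑ w, (Function.update X v (Insert.insert x (X v)) w).card =
        ∑ w, (X w).card + 1 := by
      rw [← Finset.add_sum_erase _ _ (Finset.mem_univ v),
        ← Finset.add_sum_erase _ (fun w => (X w).card) (Finset.mem_univ v),
        Function.update_self, Finset.card_insert_of_notMem hxX,
        Finset.sum_congr rfl fun w hw => by
          rw [Function.update_of_ne (Finset.ne_of_mem_erase hw)]]
      ring
    omega
  · by_cases hw : w = v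
    · subst hw
      simp only [Function.update_self]
      have hne : ∀ y ∈ X w, y ≠ x := fun y hy hyx => hxX (hyx ▸ hy)
      refine ⟨⟨fun y hy => ?_, fun y hy z hz hyz => ?_⟩, fun y hy => ?_⟩
      · rcases Finset.mem_insert.1 hy with rfl | hy
        · simpa using htrig
        · rw [Function.update_of_ne (hne y hy)]
          exact (h4 w).1.trigger y hy
      · rcases Finset.mem_insert.1 hy with rfl | hy'
        · rcases Finset.mem_insert.1 hz with rfl | hz'
          · exact absurd rfl hyz
          -- Older last edges lie in `H` and do not serve for `x`; nothing is known about the new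
          -- edge after older failures. Hence the disjunction in `TriggerFamily`.
          · right
            rw [Function.update_of_ne (hne z hz')]
            exact fun hs => hH _ hs ((h4 w).2 z hz').2
        · rcases Finset.mem_insert.1 hz with rfl | hz'
          · left
            rw [Function.update_of_ne hyz]
            exact fun hs => hH _ hs ((h4 w).2 y hy').2
          · rw [Function.update_of_ne (hne y hy'), Function.update_of_ne (hne z hz')]
            exact (h4 w).1.pair y hy' z hz' hyz
      · rcases Finset.mem_insert.1 hy with rfl | hy
        · exact ⟨hxK, by simp⟩
        · rw [Function.update_of_ne (hne y hy)]
          exact ⟨((h4 w).2 y hy).1, Set.mem_insert_of_mem _ ((h4 w).2 y hy).2⟩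
    · rw [Function.update_of_ne hw, Function.update_of_ne hw]
      exact ⟨(h4 w).1, fun y hy => ⟨((h4 w).2 y hy).1,
        Set.mem_insert_of_mem _ ((h4 w).2 y hy).2⟩⟩

theorem Certified.ncard_le {K m : ℕ} {H₀ H : Set (Sym2 V)} (h : Certified G s p K H₀ H)
    (hm : ∀ (v : V) (X : Finset V) (u : V → V), TriggerFamily G s p v X u →
      (∀ x ∈ X, ¬ Dense p K x) → X.card ≤ m) :
    H.ncard ≤ H₀.ncard + Fintype.card V * m := by
  obtain ⟨-, -, X, u, h3, h4⟩ := h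
  refine h3.trans (Nat.add_le_add_left ?_ _)
  refine (Finset.sum_le_card_nsmul _ _ m fun v _ =>
    hm v (X v) (u v) (h4 v).1 fun x hx => ((h4 v).2 x hx).1).trans_eq ?_
  rw [Finset.card_univ, smul_eq_mul]

/-- By induction on the distance, the last edges chain up to a path of the same length. This reduces
distance preservation to one edge per vertex. -/
theorem edist_le_of_last_edges {G H : SimpleGraph V}
    (h : ∀ v, v ≠ s → cdist G s v < Fintype.card V →
      ∃ u, H.Adj u v ∧ cdist G s u + 1 = cdist G s v) (v : V) :
    H.edist s v ≤ G.edist s v := by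
  by_cases ht : G.edist s v = ⊤
  · rw [ht]; exact le_top
  have key : ∀ (m : ℕ) (v : V), cdist G s v = m → m < Fintype.card V → H.edist s v ≤ m := by
    intro m
    induction m with
    | zero =>
      intro v hv hm
      by_cases hs : v = s
      · simp [hs]
      · obtain ⟨u, -, hu⟩ := h v hs (hv ▸ hm)
        omega
    | succ m ih =>
      intro v hv hm
      by_cases hs : v = s
      · simp [hs]
      · obtain ⟨u, hadj, hu⟩ := h v hs (hv ▸ hm)
        rw [Nat.cast_add]
        refine SimpleGraph.edist_triangle.trans (add_le_add (ih u (by omega) (by omega)) ?_)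
        simp [SimpleGraph.edist_eq_one_iff_adj.2 hadj]
  have h1 := edist_lt_card ht
  have h2 := edist_eq_tdist_card ht
  rw [h2] at h1 ⊢
  exact key _ v rfl (by exact_mod_cast h1)

/-- The tree edges above the dense vertices. -/
def denseEdges (p : V → V) (K : ℕ) : Set (Sym2 V) :=
  {e | ∃ x, p x ≠ x ∧ Dense p K x ∧ e = s(p x, x)}

theorem ncard_denseEdges_le (p : V → V) {K : ℕ} (hK : 0 < K) :
    ((denseEdges p K).ncard : ℝ) ≤ Fintype.card V * (harmonic (Fintype.card V) : ℝ) / K := by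
  refine le_trans ?_ (card_dense_le p hK)
  have : denseEdges p K ⊆ (fun x => s(p x, x)) '' {x | Dense p K x} := by
    rintro e ⟨x, -, hx, rfl⟩
    exact ⟨x, hx, rfl⟩
  exact_mod_cast (Set.ncard_le_ncard this (Set.toFinite _)).trans
    (Set.ncard_image_le (Set.toFinite _))

/-- After the failure of any tree edge whose lower endpoint is not dense, the edge set `H` contains
the last edge of a shortest path to every vertex. -/
def Complete (G : SimpleGraph V) (s : V) (p : V → V) (K : ℕ) (H : Set (Sym2 V)) : Prop :=
  ∀ x, p x ≠ x → ¬ Dense p K x → ∀ v, (∃ u, Sat G s s(p x, x) u v) →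
    ∃ u, Sat G s s(p x, x) u v ∧ s(u, v) ∈ H

theorem edist_le_of_complete (hp : IsParent G s p) {K : ℕ} {H : Set (Sym2 V)}
    (htree : ∀ v, p v ≠ v → s(p v, v) ∈ H) (hH : Complete G s p K H) {e : Sym2 V}
    (he : e ∉ denseEdges p K) (v : V) :
    ((SimpleGraph.fromEdgeSet H).deleteEdges {e}).edist s v ≤ (G.deleteEdges {e}).edist s v := by
  by_cases hx : ∃ x, p x ≠ x ∧ e = s(p x, x)
  · obtain ⟨x, hx, rfl⟩ := hx
    have hd : ¬ Dense p K x := fun h => he ⟨x, hx, h, rfl⟩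
    refine edist_le_of_last_edges (fun v hv hlt => ?_) v
    obtain ⟨c, hc1, hc2⟩ := exists_adj_tdist hv hlt
    obtain ⟨u, hu1, hu2⟩ := hH x hx hd v ⟨c, hc1, hc2⟩
    refine ⟨u, ?_, hu1.2⟩
    have := hu1.1
    rw [SimpleGraph.deleteEdges_adj] at this ⊢
    exact ⟨(SimpleGraph.fromEdgeSet_adj _).2 ⟨hu2, this.1.ne⟩, this.2⟩
  · refine le_trans ?_ (SimpleGraph.edist_anti (SimpleGraph.deleteEdges_le {e}))
    refine edist_le_of_last_edges (fun v hv hlt => ?_) v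
    have h1 := hp.reach v hv hlt
    refine ⟨p v, ?_, hp.depth v h1⟩
    rw [SimpleGraph.deleteEdges_adj]
    refine ⟨(SimpleGraph.fromEdgeSet_adj _).2 ⟨htree v h1, h1⟩, fun h => hx ⟨v, h1, ?_⟩⟩
    exact (Set.mem_singleton_iff.1 h).symm

theorem edgeSet_fromEdgeSet_of_subset {V : Type*} {G : SimpleGraph V} {H : Set (Sym2 V)}
    (h : H ⊆ G.edgeSet) :
    (SimpleGraph.fromEdgeSet H).edgeSet = H := by
  rw [SimpleGraph.edgeSet_fromEdgeSet, sdiff_eq_left, Set.disjoint_left]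
  intro e he hd
  exact SimpleGraph.not_isDiag_of_mem_edgeSet G (h he) hd

theorem fromEdgeSet_le_of_subset {V : Type*} {G : SimpleGraph V} {H : Set (Sym2 V)}
    (h : H ⊆ G.edgeSet) :
    SimpleGraph.fromEdgeSet H ≤ G := by
  intro a b hab
  exact h ((SimpleGraph.fromEdgeSet_adj _).1 hab).1

theorem unprotected_subset (hp : IsParent G s p) {K : ℕ} {H : Set (Sym2 V)}
    (hHG : H ⊆ G.edgeSet) (htree : ∀ v, p v ≠ v → s(p v, v) ∈ H) (hH : Complete G s p K H) :
    unprotected G (SimpleGraph.fromEdgeSet H) s ⊆ denseEdges p K := by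
  intro e he
  by_contra hd
  refine he.2 fun v => le_antisymm (edist_le_of_complete hp htree hH hd v) ?_
  exact SimpleGraph.edist_anti (SimpleGraph.deleteEdges_mono (fromEdgeSet_le_of_subset hHG))

end Collections
/-! ## Programs with bounded loops -/

theorem State.vars_setVar (σ : State) (x m y : ℕ) :
    (σ.setVar x m).vars y = if y = x then m else σ.vars y := by
  simp [State.setVar, Function.update_apply]

theorem State.arrays_setVar (σ : State) (x m : ℕ) : (σ.setVar x m).arrays = σ.arrays := rfl

theorem State.vars_setEntry (σ : State) (a i j m : ℕ) : (σ.setEntry a i j m).vars = σ.vars := rfl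

theorem State.arrays_setEntry (σ : State) (a i j m b k l : ℕ) :
    (σ.setEntry a i j m).arrays b k l =
      if b = a ∧ k = i ∧ l = j then m else σ.arrays b k l := by
  simp only [State.setEntry, Function.update_apply]
  by_cases h1 : b = a
  · subst h1
    by_cases h2 : k = i
    · subst h2
      by_cases h3 : l = j <;> simp [h3]
    · simp [h2]
  · simp [h1]

/-- Programs in which every loop runs through the numbers below the value of the variable `0`. -/
inductive Cmd : Type
  | skip
  | assign (x : ℕ) (p : Expr)
  | write (a : ℕ) (i j p : Expr)
  | seq (P Q : Cmd)
  | ite (p : Expr) (P Q : Cmd)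
  | loop (x : ℕ) (P : Cmd)

namespace Cmd

/-- The random access program for a bounded loop program. -/
def toProg : Cmd → Prog
  | skip => .skip
  | assign x p => .assign x p
  | write a i j p => .write a i j p
  | seq P Q => .seq P.toProg Q.toProg
  | ite p P Q => .ite p P.toProg Q.toProg
  | loop x P => .seq (.assign x (.const 0))
      (.while (.sub (.var 0) (.var x)) (.seq P.toProg (.assign x (.add (.var x) (.const 1)))))

/-- The memory after the execution of a bounded loop program. -/
noncomputable def den (ε : ℝ) : Cmd → State → State
  | skip, σ => σ
  | assign x p, σ => σ.setVar x (p.eval ε σ)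
  | write a i j p, σ => σ.setEntry a (i.eval ε σ) (j.eval ε σ) (p.eval ε σ)
  | seq P Q, σ => Q.den ε (P.den ε σ)
  | ite p P Q, σ => if p.eval ε σ = 0 then Q.den ε σ else P.den ε σ
  | loop x P, σ => Nat.rec (motive := fun _ => State) (σ.setVar x 0)
      (fun i τ => (P.den ε τ).setVar x (i + 1)) (σ.vars 0)

/-- The variables that a program can change. -/
def vars : Cmd → List ℕ
  | skip => []
  | assign x _ => [x]
  | write _ _ _ _ => []
  | seq P Q => P.vars ++ Q.vars
  | ite _ P Q => P.vars ++ Q.vars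
  | loop x P => x :: P.vars

/-- The arrays that a program can change. -/
def arrays : Cmd → List ℕ
  | skip => []
  | assign _ _ => []
  | write a _ _ _ => [a]
  | seq P Q => P.arrays ++ Q.arrays
  | ite _ P Q => P.arrays ++ Q.arrays
  | loop _ P => P.arrays

/-- No loop variable is changed in the body of its loop, and the variable `0` is never changed. -/
def WellFormed : Cmd → Bool
  | skip => true
  | assign x _ => x != 0
  | write _ _ _ _ => true
  | seq P Q => P.WellFormed && Q.WellFormed
  | ite _ P Q => P.WellFormed && Q.WellFormed
  | loop x P => x != 0 && !P.vars.contains x && P.WellFormed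

/-- A bound for the number of steps, in terms of the value of the variable `0`. -/
noncomputable def time : Cmd → Polynomial ℕ
  | skip => 1
  | assign _ p => .C (p.cost + 1)
  | write _ i j p => .C (i.cost + j.cost + p.cost + 1)
  | seq P Q => P.time + Q.time
  | ite p P Q => .C (p.cost + 1) + P.time + Q.time
  | loop _ P => .C 6 + .X * (P.time + .C 8)

theorem vars_den (ε : ℝ) : ∀ (c : Cmd) (σ : State) {y : ℕ}, y ∉ c.vars →
    (c.den ε σ).vars y = σ.vars y
  | skip, _, _, _ => rfl
  | assign x p, σ, y, h => by
    rw [den, State.vars_setVar, if_neg (by simpa [vars] using h)]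
  | write _ _ _ _, _, _, _ => rfl
  | seq P Q, σ, y, h => by
    simp only [vars, List.mem_append, not_or] at h
    rw [den, vars_den ε Q _ h.2, vars_den ε P _ h.1]
  | ite p P Q, σ, y, h => by
    simp only [vars, List.mem_append, not_or] at h
    rw [den]
    split_ifs
    · exact vars_den ε Q _ h.2
    · exact vars_den ε P _ h.1
  | loop x P, σ, y, h => by
    simp only [vars, List.mem_cons, not_or] at h
    rw [den]
    generalize σ.vars 0 = n
    induction n with
    | zero => exact (State.vars_setVar σ x 0 y).trans (if_neg h.1)
    | succ n ih => rw [State.vars_setVar, if_neg h.1, vars_den ε P _ h.2, ih]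

theorem arrays_den (ε : ℝ) : ∀ (c : Cmd) (σ : State) {a : ℕ}, a ∉ c.arrays →
    (c.den ε σ).arrays a = σ.arrays a
  | skip, _, _, _ => rfl
  | assign x p, σ, y, h => rfl
  | write b i j p, σ, a, h => by
    funext k l
    rw [den, State.arrays_setEntry, if_neg]
    rintro ⟨rfl, -⟩
    simp [arrays] at h
  | seq P Q, σ, y, h => by
    simp only [arrays, List.mem_append, not_or] at h
    rw [den, arrays_den ε Q _ h.2, arrays_den ε P _ h.1]
  | ite p P Q, σ, y, h => by
    simp only [arrays, List.mem_append, not_or] at h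
    rw [den]
    split_ifs
    · exact arrays_den ε Q _ h.2
    · exact arrays_den ε P _ h.1
  | loop x P, σ, y, h => by
    rw [den]
    generalize σ.vars 0 = n
    induction n with
    | zero => rfl
    | succ n ih => rw [State.arrays_setVar, arrays_den ε P _ h, ih]

theorem WellFormed.zero_notMem : ∀ {c : Cmd}, c.WellFormed = true → 0 ∉ c.vars
  | skip, _ => by simp [vars]
  | assign x p, h => by
    simp only [WellFormed, bne_iff_ne] at h
    simpa [vars] using h.symm
  | write _ _ _ _, _ => by simp [vars]
  | seq P Q, h => by
    simp only [WellFormed, Bool.and_eq_true] at h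
    simp [vars, zero_notMem h.1, zero_notMem h.2]
  | ite p P Q, h => by
    simp only [WellFormed, Bool.and_eq_true] at h
    simp [vars, zero_notMem h.1, zero_notMem h.2]
  | loop x P, h => by
    simp only [WellFormed, Bool.and_eq_true, bne_iff_ne] at h
    simp [vars, zero_notMem h.2, h.1.1.symm]

/-- Well-formedness makes the loop counter and the variable `0` invariant under the body, so a loop
runs exactly `n` rounds and the polynomial bound of the body applies in each of them. -/
theorem exec_den (ε : ℝ) : ∀ (c : Cmd) (σ : State), c.WellFormed = true →
    ∃ t ≤ c.time.eval (σ.vars 0), Exec ε c.toProg σ t (c.den ε σ)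
  | skip, σ, _ => ⟨1, by simp [time], Exec.skip σ⟩
  | assign x p, σ, _ => ⟨_, by simp [time], Exec.assign σ x p⟩
  | write a i j p, σ, _ => ⟨_, by simp [time], Exec.write σ a i j p⟩
  | seq P Q, σ, h => by
    simp only [WellFormed, Bool.and_eq_true] at h
    obtain ⟨t, ht, hP⟩ := exec_den ε P σ h.1
    obtain ⟨u, hu, hQ⟩ := exec_den ε Q (P.den ε σ) h.2
    rw [vars_den ε P σ (WellFormed.zero_notMem h.1)] at hu
    exact ⟨t + u, by simpa [time] using Nat.add_le_add ht hu, Exec.seq hP hQ⟩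
  | ite p P Q, σ, h => by
    simp only [WellFormed, Bool.and_eq_true] at h
    by_cases hp : p.eval ε σ = 0
    · obtain ⟨u, hu, hQ⟩ := exec_den ε Q σ h.2
      refine ⟨p.cost + 1 + u, ?_, ?_⟩
      · simp only [time, Polynomial.eval_add, Polynomial.eval_C]
        omega
      · rw [den, if_pos hp]
        exact Exec.ite_false hp hQ
    · obtain ⟨u, hu, hP⟩ := exec_den ε P σ h.1
      refine ⟨p.cost + 1 + u, ?_, ?_⟩
      · simp only [time, Polynomial.eval_add, Polynomial.eval_C]
        omega
      · rw [den, if_neg hp]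
        exact Exec.ite_true hp hP
  | loop x P, σ, h => by
    have h0 := WellFormed.zero_notMem h
    simp only [WellFormed, Bool.and_eq_true, bne_iff_ne, Bool.not_eq_true',
      List.contains_eq_mem, decide_eq_false_iff_not] at h
    obtain ⟨⟨hx0, hxP⟩, hP⟩ := h
    set n := σ.vars 0 with hn
    set ρ : ℕ → State := fun i => Nat.rec (motive := fun _ => State) (σ.setVar x 0)
      (fun i τ => (P.den ε τ).setVar x (i + 1)) i with hρ
    have hρx : ∀ i, (ρ i).vars x = i := by
      intro i
      cases i <;> simp [hρ, State.vars_setVar]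
    have hρ0 : ∀ i, (ρ i).vars 0 = n := by
      intro i
      induction i with
      | zero => simp [hρ, State.vars_setVar, hx0.symm, hn]
      | succ i ih =>
        have : (ρ (i + 1)).vars 0 = (P.den ε (ρ i)).vars 0 := by
          simp [hρ, State.vars_setVar, hx0.symm]
        rw [this, vars_den ε P _ (WellFormed.zero_notMem hP), ih]
    have hcond : ∀ i, (Expr.sub (.var 0) (.var x)).eval ε (ρ i) = n - i := by
      intro i
      rw [Expr.eval, Expr.eval, Expr.eval, hρx, hρ0]
    -- Here `k` rounds remain. Each costs `4` for the test and `4` for the increment besides the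
    -- body; the last `4` is the failing test.
    have key : ∀ k ≤ n, ∃ t ≤ k * (P.time.eval n + 8) + 4,
        Exec ε (.while (.sub (.var 0) (.var x))
          (.seq P.toProg (.assign x (.add (.var x) (.const 1))))) (ρ (n - k)) t (ρ n) := by
      intro k
      induction k with
      | zero =>
        intro _
        refine ⟨_, ?_, Exec.while_false (by rw [hcond]; omega)⟩
        simp [Expr.cost]
      | succ k ih =>
        intro hk
        obtain ⟨t, ht, hw⟩ := ih (by omega)
        obtain ⟨u, hu, hb⟩ := exec_den ε P (ρ (n - (k + 1))) hP
        rw [hρ0] at hu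
        have hstep : ρ (n - k) = (P.den ε (ρ (n - (k + 1)))).setVar x
            ((Expr.add (.var x) (.const 1)).eval ε (P.den ε (ρ (n - (k + 1))))) := by
          have e1 : n - k = (n - (k + 1)) + 1 := by omega
          have e2 : (Expr.add (.var x) (.const 1)).eval ε (P.den ε (ρ (n - (k + 1)))) =
              n - (k + 1) + 1 := by
            rw [Expr.eval, Expr.eval, Expr.eval, vars_den ε P _ hxP, hρx]
          rw [e2, e1]
        rw [hstep] at hw
        refine ⟨_, ?_, Exec.while_true (by rw [hcond]; omega)
          (Exec.seq hb (Exec.assign _ x _)) hw⟩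
        simp only [Expr.cost]
        have : (k + 1) * (P.time.eval n + 8) = k * (P.time.eval n + 8) + (P.time.eval n + 8) :=
          Nat.succ_mul _ _
        omega
    obtain ⟨t, ht, hw⟩ := key n le_rfl
    rw [Nat.sub_self] at hw
    refine ⟨_, ?_, Exec.seq (Exec.assign σ x (.const 0)) hw⟩
    simp only [time, Expr.cost, Polynomial.eval_add, Polynomial.eval_C, Polynomial.eval_mul,
      Polynomial.eval_X]
    omega

/-- The induction step also receives the frame conditions, so that an invariant need mention only
what the body changes. -/
theorem loop_induct {ε : ℝ} {x : ℕ} {P : Cmd} {σ : State}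
    (I : ℕ → State → Prop) (h0 : I 0 (σ.setVar x 0))
    (hs : ∀ i τ, i < σ.vars 0 → τ.vars x = i → (∀ y ∉ (loop x P).vars, τ.vars y = σ.vars y) →
      (∀ a ∉ P.arrays, τ.arrays a = σ.arrays a) → I i τ →
      I (i + 1) ((P.den ε τ).setVar x (i + 1))) :
    I (σ.vars 0) ((loop x P).den ε σ) := by
  rw [den]
  have key : ∀ i ≤ σ.vars 0, ∀ τ, τ = Nat.rec (motive := fun _ => State) (σ.setVar x 0)
      (fun i τ => (P.den ε τ).setVar x (i + 1)) i →
      τ.vars x = i ∧ (∀ y ∉ (loop x P).vars, τ.vars y = σ.vars y) ∧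
      (∀ a ∉ P.arrays, τ.arrays a = σ.arrays a) ∧ I i τ := by
    intro i
    induction i with
    | zero =>
      rintro - τ rfl
      refine ⟨by simp [State.vars_setVar], fun y hy => ?_, fun a _ => rfl, h0⟩
      simp only [vars, List.mem_cons, not_or] at hy
      simp [State.vars_setVar, hy.1]
    | succ i ih =>
      rintro hi τ rfl
      obtain ⟨h1, h2, h3, h4⟩ := ih (by omega) _ rfl
      refine ⟨by simp [State.vars_setVar], fun y hy => ?_, fun a ha => ?_,
        hs i _ (by omega) h1 h2 h3 h4⟩
      · have hy' := hy
        simp only [vars, List.mem_cons, not_or] at hy'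
        rw [State.vars_setVar, if_neg hy'.1, vars_den ε P _ hy'.2, h2 y hy]
      · rw [State.arrays_setVar, arrays_den ε P _ ha, h3 a ha]
  exact (key _ le_rfl _ rfl).2.2.2

end Cmd
/-! ## The program -/

namespace Cmd

infixr:60 " ⨟ " => Cmd.seq

/-- Execute `P` if the condition is true. -/
def when (p : Expr) (P : Cmd) : Cmd := .ite p P .skip

theorem den_when (ε : ℝ) (p : Expr) (P : Cmd) (σ : State) :
    (when p P).den ε σ = if p.eval ε σ = 0 then σ else P.den ε σ := rfl

theorem den_seq (ε : ℝ) (P Q : Cmd) (σ : State) : (P ⨟ Q).den ε σ = Q.den ε (P.den ε σ) := rfl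

theorem den_assign (ε : ℝ) (x : ℕ) (p : Expr) (σ : State) :
    (assign x p).den ε σ = σ.setVar x (p.eval ε σ) := rfl

theorem den_write (ε : ℝ) (a : ℕ) (i j p : Expr) (σ : State) :
    (write a i j p).den ε σ = σ.setEntry a (i.eval ε σ) (j.eval ε σ) (p.eval ε σ) := rfl

theorem den_ite (ε : ℝ) (p : Expr) (P Q : Cmd) (σ : State) :
    (ite p P Q).den ε σ = if p.eval ε σ = 0 then Q.den ε σ else P.den ε σ := rfl

end Cmd

/-- The absolute value of the difference. -/
def Expr.absDiff (p q : Expr) : Expr := .add (.sub p q) (.sub q p)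

/-- The truth value of an equation. -/
def Expr.eq (p q : Expr) : Expr := .sub (.const 1) (.absDiff p q)

theorem Expr.eval_absDiff_eq_zero {ε : ℝ} {σ : State} {p q : Expr} :
    (Expr.absDiff p q).eval ε σ = 0 ↔ p.eval ε σ = q.eval ε σ := by
  simp only [absDiff, eval]
  omega

theorem Expr.eval_eq_eq_zero {ε : ℝ} {σ : State} {p q : Expr} :
    (Expr.eq p q).eval ε σ = 0 ↔ p.eval ε σ ≠ q.eval ε σ := by
  simp only [eq, absDiff, eval]
  omega

/-! ### The algorithm; arrays `0` to `5`: adjacency, `H`, reinforced edges, parents and last edges,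
distances, descendant counts. -/

namespace Cmd

/-- True when the vertices in the variables `11` and `10` are adjacent after the failure of the edge
between the vertices in the variables `20` and `8`. -/
def arc : Expr :=
  .sub (.read 0 (.var 11) (.var 10)) (.add
    (.sub (.const 1) (.add (.absDiff (.var 11) (.var 8)) (.absDiff (.var 10) (.var 20))))
    (.sub (.const 1) (.add (.absDiff (.var 10) (.var 8)) (.absDiff (.var 11) (.var 20)))))

/-- One step of `distances`: compare with the length of a path that ends with the arc. -/
def relax : Cmd :=
  when arc (when (.sub (.read 4 (.add (.var 9) (.const 1)) (.var 10))
      (.add (.read 4 (.var 9) (.var 11)) (.const 1)))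
    (write 4 (.add (.var 9) (.const 1)) (.var 10)
      (.add (.read 4 (.var 9) (.var 11)) (.const 1))))

/-- One entry of the array of truncated distances. -/
def distanceEntry : Cmd :=
  write 4 (.add (.var 9) (.const 1)) (.var 10) (.add (.var 9) (.const 1)) ⨟
    when (.eq (.var 10) (.var 1)) (write 4 (.add (.var 9) (.const 1)) (.var 10) (.const 0)) ⨟
    loop 11 relax

/-- The truncated distances after the failure of an edge. -/
def distances : Cmd := loop 9 (loop 10 distanceEntry)

/-- Search for the last edge of a shortest path, preferably in the current subgraph. -/
def search : Cmd :=
  assign 12 (.const 0) ⨟ loop 11 (when arc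
    (when (.eq (.add (.read 4 (.var 0) (.var 11)) (.const 1)) (.read 4 (.var 0) (.var 10)))
      (when (.add (.eq (.var 12) (.const 0)) (.read 1 (.var 11) (.var 10)))
        (assign 12 (.add (.var 11) (.const 1))))))

/-- Put the last edge found by `search` into the current subgraph. -/
def record : Cmd :=
  when (.var 12) (write 1 (.sub (.var 12) (.const 1)) (.var 10) (.const 1) ⨟
    write 1 (.var 10) (.sub (.var 12) (.const 1)) (.const 1) ⨟
    write 3 (.var 8) (.var 10) (.sub (.var 12) (.const 1)))

/-- Add last edges of shortest paths to all vertices after the failure of the edge between the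
vertices in the variables `20` and `8`. -/
def protect : Cmd := distances ⨟ loop 10 (search ⨟ record)

/-- Construct a shortest path tree. -/
def tree : Cmd :=
  loop 10 (write 3 (.var 1) (.var 10) (.var 10)) ⨟ assign 8 (.var 1) ⨟ assign 20 (.var 1) ⨟ protect

/-- Count the descendants of all vertices by their relative depths. -/
def countDescendants : Cmd :=
  loop 13 (assign 15 (.var 13) ⨟ loop 14 (
    write 5 (.var 15) (.var 14) (.add (.read 5 (.var 15) (.var 14)) (.const 1)) ⨟
    assign 15 (.read 3 (.var 1) (.var 15))))

/-- Decide whether the vertex in the variable `8` is dense. -/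
def testDense : Cmd :=
  assign 17 (.const 0) ⨟ assign 18 (.const 0) ⨟ assign 19 (.const 0) ⨟ loop 16 (
    assign 17 (.add (.var 17) (.read 5 (.var 8) (.var 16))) ⨟
    assign 18 (.add (.var 18) (.var 6)) ⨟
    when (.sub (.const 1) (.sub (.var 18) (.var 17))) (assign 19 (.const 1)))

/-- Reinforce the edge from the vertex in the variable `8` to its parent. -/
def reinforce : Cmd :=
  write 2 (.var 8) (.var 20) (.const 1) ⨟ write 2 (.var 20) (.var 8) (.const 1)

/-- Treat all tree edges. -/
def treatEdges : Cmd :=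
  loop 8 (assign 20 (.read 3 (.var 1) (.var 8)) ⨟
    when (.absDiff (.var 20) (.var 8)) (testDense ⨟ ite (.var 19) reinforce protect))

/-- Compute the binary logarithm of the number of vertices in the variable `2`. -/
def computeLog : Cmd :=
  assign 3 (.const 1) ⨟ assign 2 (.const 0) ⨟
    loop 7 (when (.sub (.add (.var 0) (.const 1)) (.add (.var 3) (.var 3)))
      (assign 3 (.add (.var 3) (.var 3)) ⨟ assign 2 (.add (.var 2) (.const 1))))

/-- Compute a power of two close to `n ^ ε` in the variable `5`. -/
def computePow : Cmd :=
  assign 5 (.const 1) ⨟ assign 4 (.const 0) ⨟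
    loop 7 (ite (.realLe (.var 2) (.var 4)) skip
      (assign 4 (.add (.var 4) (.const 1)) ⨟ assign 5 (.add (.var 5) (.var 5))))

/-- Compute the density threshold in the variable `6`: the content of the variable `5`, in the first
variant multiplied by the logarithm of the number of vertices. -/
def computeThreshold : Bool → Cmd
  | true => assign 6 (.const 0) ⨟
      loop 7 (when (.sub (.add (.var 2) (.const 1)) (.var 7)) (assign 6 (.add (.var 6) (.var 5))))
  | false => assign 6 (.var 5)

/-- The whole program. -/
def main (b : Bool) : Cmd :=
  computeLog ⨟ computePow ⨟ computeThreshold b ⨟ tree ⨟ countDescendants ⨟ treatEdges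

theorem wellFormed_main (b : Bool) : (main b).WellFormed = true := by
  cases b <;> decide

end Cmd

/-! ### Correctness of the distance computation. -/

section Specification

variable {n : ℕ} {G : SimpleGraph (Fin n)} {s : Fin n} {ε : ℝ}

open Classical in
/-- The memory contains the input graph and the source. -/
structure Env (G : SimpleGraph (Fin n)) (s : Fin n) (σ : State) : Prop where
  size : σ.vars 0 = n
  source : σ.vars 1 = s
  adj : ∀ u v : Fin n, σ.arrays 0 u v = if G.Adj u v then 1 else 0

theorem Env.den {σ : State} (h : Env G s σ) (c : Cmd) (h0 : 0 ∉ c.vars) (h1 : 1 ∉ c.vars)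
    (h2 : 0 ∉ c.arrays) : Env G s (c.den ε σ) :=
  ⟨by rw [Cmd.vars_den ε c σ h0, h.size], by rw [Cmd.vars_den ε c σ h1, h.source],
    by rw [Cmd.arrays_den ε c σ h2]; exact h.adj⟩

theorem Env.congr {σ τ : State} (h : Env G s σ) (h0 : τ.vars 0 = σ.vars 0)
    (h1 : τ.vars 1 = σ.vars 1) (h2 : τ.arrays 0 = σ.arrays 0) : Env G s τ :=
  ⟨h0.trans h.size, h1.trans h.source, by rw [h2]; exact h.adj⟩

theorem eval_arc {σ : State} (h : Env G s σ) {x q u v : Fin n} (hx : σ.vars 8 = x)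
    (hq : σ.vars 20 = q) (hu : σ.vars 11 = u) (hv : σ.vars 10 = v) :
    Cmd.arc.eval ε σ = 0 ↔ ¬ (G.deleteEdges {s(q, x)}).Adj u v := by
  have hadj := h.adj u v
  simp only [Cmd.arc, Expr.absDiff, Expr.eval, hx, hq, hu, hv, hadj]
  rw [SimpleGraph.deleteEdges_adj, Set.mem_singleton_iff, Sym2.eq_iff]
  simp only [Fin.ext_iff]
  split_ifs with hG
  · simp only [hG, true_and, not_not]
    omega
  · simp [hG]

/-- The memory contains the truncated distances from `s` in `G'` up to the row `k`. -/
def DistRows (G' : SimpleGraph (Fin n)) (s : Fin n) (k : ℕ) (σ : State) : Prop :=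
  ∀ k' ≤ k, ∀ v : Fin n, σ.arrays 4 k' v = tdist k' G' s v

theorem relax_spec {σ : State} (h : Env G s σ) {x q v : Fin n} (hx : σ.vars 8 = x)
    (hq : σ.vars 20 = q) (hv : σ.vars 10 = v) {k : ℕ} (hk : σ.vars 9 = k)
    (hrow : DistRows (G.deleteEdges {s(q, x)}) s k σ) {m : ℕ} (hm : σ.arrays 4 (k + 1) v = m)
    (hvs : v = s → m = 0) (hmk : m ≤ k + 1) (hex : v ≠ s → m = k + 1) :
    let τ := (Cmd.loop 11 Cmd.relax).den ε σ
    (∀ k' l : ℕ, ¬ (k' = k + 1 ∧ l = v) → τ.arrays 4 k' l = σ.arrays 4 k' l) ∧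
      τ.arrays 4 (k + 1) v = tdist (k + 1) (G.deleteEdges {s(q, x)}) s v := by
  intro τ
  set G' := G.deleteEdges {s(q, x)} with hG'
  -- For `v ≠ s` the entry is at most every candidate seen so far, and is the cap or an actual
  -- candidate: the hypotheses of `eq_tdist_succ`.
  have key := Cmd.loop_induct (ε := ε) (x := 11) (P := Cmd.relax) (σ := σ) (fun i τ =>
    (∀ k' l : ℕ, ¬ (k' = k + 1 ∧ l = v) → τ.arrays 4 k' l = σ.arrays 4 k' l) ∧
    (v = s → τ.arrays 4 (k + 1) v = 0) ∧ τ.arrays 4 (k + 1) v ≤ k + 1 ∧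
    (∀ u : Fin n, (u : ℕ) < i → G'.Adj u v → τ.arrays 4 (k + 1) v ≤ tdist k G' s u + 1) ∧
    (v ≠ s → τ.arrays 4 (k + 1) v = k + 1 ∨
      ∃ u, G'.Adj u v ∧ τ.arrays 4 (k + 1) v = tdist k G' s u + 1))
    ⟨fun _ _ _ => rfl, fun h => hm.trans (hvs h), hm.trans_le hmk,
      fun _ h => absurd h (Nat.not_lt_zero _), fun h => Or.inl (hm.trans (hex h))⟩ ?_
  · obtain ⟨k1, k2, k3, k4, k5⟩ := key
    refine ⟨k1, ?_⟩
    by_cases hs : v = s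
    · refine (k2 hs).trans ?_
      rw [hs, tdist_self]
    · refine eq_tdist_succ hs k3 (fun c hc => k4 c ?_ hc) (k5 hs)
      rw [h.size]; exact c.2
  · rintro i τ hi hτi hτv hτa ⟨k1, k2, k3, k4, k5⟩
    have e0 := hτv 0 (by decide)
    have e1 := hτv 1 (by decide)
    have e8 := hτv 8 (by decide)
    have e9 := hτv 9 (by decide)
    have e10 := hτv 10 (by decide)
    have e20 := hτv 20 (by decide)
    have hE : Env G s τ := h.congr e0 e1 (hτa 0 (by decide))
    rw [h.size] at hi
    set u : Fin n := ⟨i, hi⟩ with hu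
    have harc := eval_arc (ε := ε) hE (e8.trans hx) (e20.trans hq) (u := u) hτi (e10.trans hv)
    have hku : τ.arrays 4 k i = tdist k G' s u := by
      rw [k1 k i (by omega)]
      exact hrow k le_rfl u
    have hlt : ∀ w : Fin n, (w : ℕ) < i + 1 → (w : ℕ) < i ∨ w = u := by
      intro w hw
      rcases Nat.lt_succ_iff_lt_or_eq.1 hw with h | h
      · exact Or.inl h
      · exact Or.inr (Fin.ext h)
    rw [Cmd.relax, Cmd.den_when]
    split_ifs with hA
    · rw [harc] at hA
      refine ⟨k1, k2, k3, fun w hw hadj => ?_, k5⟩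
      rcases hlt w hw with hw | rfl
      · exact k4 w hw hadj
      · exact absurd hadj hA
    · have hadj : G'.Adj u v := not_not.1 fun hn => hA (harc.2 hn)
      rw [Cmd.den_when]
      simp only [Expr.eval, e9.trans hk, e10.trans hv, hτi, hku]
      split_ifs with hB
      · refine ⟨k1, k2, k3, fun w hw hadj => ?_, k5⟩
        rcases hlt w hw with hw | rfl
        · exact k4 w hw hadj
        · rw [State.arrays_setVar]; omega
      · simp only [Cmd.den_write, Expr.eval, e9.trans hk, e10.trans hv, hτi, hku,
          State.arrays_setVar, State.arrays_setEntry]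
        refine ⟨fun k' l hkl => ?_, ?_, ?_, fun w hw hadj => ?_, fun hs => Or.inr ?_⟩
        · rw [if_neg (by simpa using hkl)]
          exact k1 k' l hkl
        · intro hs
          have := k2 hs
          omega
        · simp only [and_self, if_true]
          omega
        · simp only [and_self, if_true]
          rcases hlt w hw with hw | rfl
          · have := k4 w hw hadj
            omega
          · exact le_rfl
        · exact ⟨u, hadj, by simp⟩

theorem distanceEntry_spec {σ : State} (h : Env G s σ) {x q v : Fin n} (hx : σ.vars 8 = x)
    (hq : σ.vars 20 = q) (hv : σ.vars 10 = v) {k : ℕ} (hk : σ.vars 9 = k)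
    (hrow : DistRows (G.deleteEdges {s(q, x)}) s k σ) :
    let τ := Cmd.distanceEntry.den ε σ
    (∀ k' l : ℕ, ¬ (k' = k + 1 ∧ l = v) → τ.arrays 4 k' l = σ.arrays 4 k' l) ∧
      τ.arrays 4 (k + 1) v = tdist (k + 1) (G.deleteEdges {s(q, x)}) s v := by
  intro τ
  set ρ := (Cmd.when (.eq (.var 10) (.var 1))
    (.write 4 (.add (.var 9) (.const 1)) (.var 10) (.const 0))).den ε
    ((Cmd.write 4 (.add (.var 9) (.const 1)) (.var 10) (.add (.var 9) (.const 1))).den ε σ)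
    with hρ
  have hτ : τ = (Cmd.loop 11 Cmd.relax).den ε ρ := rfl
  have hvars : ρ.vars = σ.vars := by
    rw [hρ, Cmd.den_when]
    split_ifs <;> rfl
  have harr : ∀ a k' l, ρ.arrays a k' l =
      if a = 4 ∧ k' = k + 1 ∧ l = v then if v = s then 0 else k + 1 else σ.arrays a k' l := by
    intro a k' l
    rw [hρ, Cmd.den_when]
    simp only [Expr.eval_eq_eq_zero, Cmd.den_write, Expr.eval, State.vars_setEntry, hk, hv,
      h.source, ← Fin.ext_iff, ne_eq]
    split_ifs with h1 h2 h3 <;> simp_all [State.arrays_setEntry]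
  have hE : Env G s ρ := h.congr (by rw [hvars]) (by rw [hvars]) (by
    funext i j
    rw [harr, if_neg (by simp)])
  obtain ⟨r1, r2⟩ := relax_spec (ε := ε) hE (x := x) (q := q) (v := v) (k := k)
    (by rw [hvars, hx]) (by rw [hvars, hq]) (by rw [hvars, hv]) (by rw [hvars, hk])
    (fun k' hk' w => by rw [harr, if_neg (by omega)]; exact hrow k' hk' w) rfl
    (fun hs => by rw [harr]; simp [hs]) (by rw [harr]; simp; split_ifs <;> omega)
    (fun hs => by rw [harr]; simp [hs])
  refine ⟨fun k' l hkl => ?_, r2⟩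
  rw [hτ, r1 k' l hkl, harr, if_neg (by tauto)]

/-- Row `n` has cap `n`, so it is `cdist`. That row `0` remains zero allows the array to be reused
for the next failing edge. -/
theorem distances_spec {σ : State} (h : Env G s σ) {x q : Fin n} (hx : σ.vars 8 = x)
    (hq : σ.vars 20 = q) (hrow : ∀ v : Fin n, σ.arrays 4 0 v = 0) (v : Fin n) :
    (Cmd.distances.den ε σ).arrays 4 0 v = 0 ∧
    (Cmd.distances.den ε σ).arrays 4 n v = cdist (G.deleteEdges {s(q, x)}) s v := by
  have hzero : ∀ v : Fin n, tdist 0 (G.deleteEdges {s(q, x)}) s v = 0 := fun v =>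
    Nat.le_zero.1 (tdist_le _ _ _ _)
  have key := Cmd.loop_induct (ε := ε) (x := 9) (P := .loop 10 Cmd.distanceEntry) (σ := σ)
    (fun k τ => DistRows (G.deleteEdges {s(q, x)}) s k τ)
    (fun k' hk' v => by
      obtain rfl := Nat.le_zero.1 hk'
      rw [hzero]
      exact hrow v) ?_
  · rw [h.size] at key
    refine ⟨?_, ?_⟩
    · rw [Cmd.distances, key 0 (Nat.zero_le _) v, hzero]
    · rw [Cmd.distances, key n le_rfl v, cdist, Fintype.card_fin]
  · intro k τ hk hτk hτv hτa hI
    have hE : Env G s τ := h.congr (hτv 0 (by decide)) (hτv 1 (by decide)) (hτa 0 (by decide))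
    have e8 := hτv 8 (by decide)
    have e20 := hτv 20 (by decide)
    have key2 := Cmd.loop_induct (ε := ε) (x := 10) (P := Cmd.distanceEntry) (σ := τ)
      (fun i ρ => DistRows (G.deleteEdges {s(q, x)}) s k ρ ∧ ∀ v : Fin n, (v : ℕ) < i →
        ρ.arrays 4 (k + 1) v = tdist (k + 1) (G.deleteEdges {s(q, x)}) s v)
      ⟨hI, fun v hv => absurd hv (Nat.not_lt_zero _)⟩ ?_
    · rw [hE.size] at key2
      intro k' hk' v
      rw [State.arrays_setVar]
      rcases Nat.le_succ_iff.1 hk' with h1 | rfl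
      · exact key2.1 k' h1 v
      · exact key2.2 v v.2
    · rintro i ρ hi hρi hρv hρa ⟨h1, h2⟩
      rw [hE.size] at hi
      have hE' : Env G s ρ := hE.congr (hρv 0 (by decide)) (hρv 1 (by decide)) (hρa 0 (by decide))
      obtain ⟨r1, r2⟩ := distanceEntry_spec (ε := ε) hE' (x := x) (q := q) (v := ⟨i, hi⟩) (k := k)
        (by rw [hρv 8 (by decide), e8, hx]) (by rw [hρv 20 (by decide), e20, hq]) hρi
        (by rw [hρv 9 (by decide), hτk]) h1
      refine ⟨fun k' hk' w => ?_, fun w hw => ?_⟩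
      · rw [State.arrays_setVar, r1 _ _ (by omega)]
        exact h1 k' hk' w
      · rw [State.arrays_setVar]
        by_cases hwi : (w : ℕ) = i
        · obtain rfl : w = ⟨i, hi⟩ := Fin.ext hwi
          exact r2
        · rw [r1 _ _ (by simpa using hwi)]
          exact h2 w (by omega)

end Specification

/-! ### Correctness of the search for last edges and of the tree construction. -/

section Protect

variable {n : ℕ} {G : SimpleGraph (Fin n)} {s : Fin n} {ε : ℝ}

theorem Fin.lt_succ_cases {i : ℕ} (hi : i < n) {w : Fin n} (hw : (w : ℕ) < i + 1) :
    (w : ℕ) < i ∨ w = ⟨i, hi⟩ := by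
  rcases Nat.lt_succ_iff_lt_or_eq.1 hw with h | h
  · exact Or.inl h
  · exact Or.inr (Fin.ext h)

theorem State.Holds.eq_zero_iff {σ : State} {a : ℕ} {H : Set (Sym2 (Fin n))} (h : σ.Holds a H)
    (u v : Fin n) : σ.arrays a u v = 0 ↔ s(u, v) ∉ H := by
  refine ⟨fun h0 hm => ?_, (h u v).2⟩
  rw [(h u v).1 hm] at h0
  exact one_ne_zero h0

/-- The result is stored as `c + 1`, so that `0` means failure. A stored candidate is replaced only
by one whose edge is in `H`, so an edge of `H` is returned whenever one serves. -/
theorem search_spec {σ : State} (h : Env G s σ) {x q v : Fin n} (hx : σ.vars 8 = x)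
    (hq : σ.vars 20 = q) (hv : σ.vars 10 = v)
    (hd : ∀ w : Fin n, σ.arrays 4 n w = cdist (G.deleteEdges {s(q, x)}) s w)
    {H : Set (Sym2 (Fin n))} (hH : σ.Holds 1 H) :
    ((Cmd.search.den ε σ).vars 12 = 0 ∧ ∀ u, ¬ Sat G s s(q, x) u v) ∨
    ∃ c : Fin n, (Cmd.search.den ε σ).vars 12 = c + 1 ∧ Sat G s s(q, x) c v ∧
      ((∃ u, Sat G s s(q, x) u v ∧ s(u, v) ∈ H) → s(c, v) ∈ H) := by
  rw [Cmd.search, Cmd.den_seq]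
  set ρ := (Cmd.assign 12 (.const 0)).den ε σ with hρ
  have hρv : ∀ y, y ≠ 12 → ρ.vars y = σ.vars y := fun y hy => by
    rw [hρ, Cmd.den_assign, State.vars_setVar, if_neg hy]
  have hE : Env G s ρ := h.congr (hρv 0 (by decide)) (hρv 1 (by decide)) rfl
  have key := Cmd.loop_induct (ε := ε) (x := 11) (σ := ρ) (P := Cmd.when Cmd.arc
    (Cmd.when (.eq (.add (.read 4 (.var 0) (.var 11)) (.const 1)) (.read 4 (.var 0) (.var 10)))
      (Cmd.when (.add (.eq (.var 12) (.const 0)) (.read 1 (.var 11) (.var 10)))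
        (Cmd.assign 12 (.add (.var 11) (.const 1))))))
    (fun i τ => (τ.vars 12 = 0 ∧ ∀ u : Fin n, (u : ℕ) < i → ¬ Sat G s s(q, x) u v) ∨
      ∃ c : Fin n, τ.vars 12 = c + 1 ∧ Sat G s s(q, x) c v ∧
        ((∃ u : Fin n, (u : ℕ) < i ∧ Sat G s s(q, x) u v ∧ s(u, v) ∈ H) → s(c, v) ∈ H))
    (Or.inl ⟨by simp [State.vars_setVar, hρ, Cmd.den_assign, Expr.eval],
      fun _ hu => absurd hu (Nat.not_lt_zero _)⟩) ?_
  · rw [hE.size] at key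
    rcases key with ⟨k1, k2⟩ | ⟨c, k1, k2, k3⟩
    · exact Or.inl ⟨k1, fun u => k2 u u.2⟩
    · exact Or.inr ⟨c, k1, k2, fun ⟨u, hu⟩ => k3 ⟨u, u.2, hu⟩⟩
  · intro i τ hi hτi hτv hτa hI
    have e0 := hτv 0 (by decide)
    have e8 := (hτv 8 (by decide)).trans ((hρv 8 (by decide)).trans hx)
    have e10 := (hτv 10 (by decide)).trans ((hρv 10 (by decide)).trans hv)
    have e20 := (hτv 20 (by decide)).trans ((hρv 20 (by decide)).trans hq)
    have hE' : Env G s τ := hE.congr e0 (hτv 1 (by decide)) (hτa 0 (by decide))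
    have hH' : τ.Holds 1 H := by
      have a1 : τ.arrays 1 = σ.arrays 1 := hτa 1 (by decide)
      intro u w
      rw [a1]
      exact hH u w
    rw [hE.size] at hi
    set u : Fin n := ⟨i, hi⟩ with hu
    have harc := eval_arc (ε := ε) hE' e8 e20 (u := u) hτi e10
    have hd' : ∀ w : Fin n, τ.arrays 4 n w = cdist (G.deleteEdges {s(q, x)}) s w := by
      have a4 : τ.arrays 4 = σ.arrays 4 := hτa 4 (by decide)
      intro w
      rw [a4]
      exact hd w
    have hsat : Sat G s s(q, x) u v ↔ Cmd.arc.eval ε τ ≠ 0 ∧ (Expr.eq (.add (.read 4 (.var 0)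
        (.var 11)) (.const 1)) (.read 4 (.var 0) (.var 10))).eval ε τ ≠ 0 := by
      rw [Sat, ne_eq, harc, not_not, ne_eq, Expr.eval_eq_eq_zero, ne_eq, not_not]
      simp only [Expr.eval, hE'.size, e10, hτi]
      rw [hd' v, show τ.arrays 4 n i = _ from hd' u]
    have hskip : ∀ τ' : State, τ'.vars 12 = τ.vars 12 → ¬ Sat G s s(q, x) u v →
        (τ'.vars 12 = 0 ∧ ∀ u : Fin n, (u : ℕ) < i + 1 → ¬ Sat G s s(q, x) u v) ∨
        ∃ c : Fin n, τ'.vars 12 = c + 1 ∧ Sat G s s(q, x) c v ∧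
        ((∃ u : Fin n, (u : ℕ) < i + 1 ∧ Sat G s s(q, x) u v ∧ s(u, v) ∈ H) → s(c, v) ∈ H) := by
      intro τ' hτ' hn
      rw [hτ']
      rcases hI with ⟨i1, i2⟩ | ⟨c, i1, i2, i3⟩
      · refine Or.inl ⟨i1, fun w hw => ?_⟩
        rcases Fin.lt_succ_cases hi hw with hw | rfl
        · exact i2 w hw
        · exact hn
      · refine Or.inr ⟨c, i1, i2, fun ⟨w, hw, hw2⟩ => ?_⟩
        rcases Fin.lt_succ_cases hi hw with hw | rfl
        · exact i3 ⟨w, hw, hw2⟩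
        · exact absurd hw2.1 hn
    have hset : ∀ (τ' : State) (m : ℕ), (τ'.setVar 11 m).vars 12 = τ'.vars 12 := fun τ' m => by
      rw [State.vars_setVar, if_neg (by decide)]
    rw [Cmd.den_when]
    split_ifs with hA
    · exact hskip _ (hset _ _) fun hs => (hsat.1 hs).1 hA
    rw [Cmd.den_when]
    split_ifs with hB
    · exact hskip _ (hset _ _) fun hs => (hsat.1 hs).2 hB
    have hs := hsat.2 ⟨hA, hB⟩
    rw [Cmd.den_when]
    split_ifs with hC
    · rw [hset]
      simp only [Expr.eval, Nat.add_eq_zero_iff, hτi, e10] at hC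
      obtain ⟨hC1, hC2⟩ := hC
      have hC1' := Expr.eval_eq_eq_zero.1 hC1
      simp only [Expr.eval] at hC1'
      rcases hI with ⟨i1, i2⟩ | ⟨c, i1, i2, i3⟩
      · exact absurd i1 hC1'
      · refine Or.inr ⟨c, i1, i2, fun ⟨w, hw, hw2⟩ => ?_⟩
        rcases Fin.lt_succ_cases hi hw with hw | rfl
        · exact i3 ⟨w, hw, hw2⟩
        · exact absurd hw2.2 ((hH'.eq_zero_iff u v).1 hC2)
    · rw [hset]
      refine Or.inr ⟨u, ?_, hs, fun ⟨w, hw, hw2⟩ => ?_⟩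
      · rw [Cmd.den_assign, State.vars_setVar, if_pos rfl]
        simp only [Expr.eval, hτi]
        rfl
      · have hC' : ¬ ((Expr.eq (.var 12) (.const 0)).eval ε τ = 0 ∧ τ.arrays 1 u v = 0) := by
          intro hc
          refine hC ?_
          simp only [Expr.eval, Nat.add_eq_zero_iff, hτi, e10]
          exact hc
        rw [Expr.eval_eq_eq_zero, hH'.eq_zero_iff] at hC'
        by_contra hn
        refine hC' ⟨?_, hn⟩
        simp only [Expr.eval]
        rcases hI with ⟨i1, i2⟩ | ⟨c, i1, i2, i3⟩
        · rcases Fin.lt_succ_cases hi hw with hw | rfl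
          · exact absurd hw2.1 (i2 w hw)
          · exact absurd hw2.2 hn
        · omega

theorem holds_insert {σ τ : State} {a : ℕ} {H : Set (Sym2 (Fin n))} (h : σ.Holds a H)
    {c v : Fin n} (hτ : ∀ i j : Fin n, τ.arrays a i j =
      if (i = c ∧ j = v) ∨ (i = v ∧ j = c) then 1 else σ.arrays a i j) :
    τ.Holds a (insert s(c, v) H) := by
  intro i j
  rw [hτ, Set.mem_insert_iff, Sym2.eq_iff]
  split_ifs with h1
  · exact ⟨fun _ => rfl, fun hn => absurd (Or.inl h1) hn⟩
  · exact ⟨fun hm => (h i j).1 (hm.resolve_left h1), fun hn => (h i j).2 fun hm => hn (Or.inr hm)⟩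

theorem protect_entry_spec {σ : State} (h : Env G s σ) {x q v : Fin n} (hx : σ.vars 8 = x)
    (hq : σ.vars 20 = q) (hv : σ.vars 10 = v)
    (hd : ∀ w : Fin n, σ.arrays 4 n w = cdist (G.deleteEdges {s(q, x)}) s w)
    {H : Set (Sym2 (Fin n))} (hH : σ.Holds 1 H) :
    let τ := (Cmd.seq Cmd.search Cmd.record).den ε σ
    ((∀ u, ¬ Sat G s s(q, x) u v) ∧ τ.Holds 1 H ∧ τ.arrays 3 = σ.arrays 3) ∨
    ∃ c : Fin n, Sat G s s(q, x) c v ∧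
      ((∃ u, Sat G s s(q, x) u v ∧ s(u, v) ∈ H) → s(c, v) ∈ H) ∧
      τ.Holds 1 (insert s(c, v) H) ∧
      ∀ i j, τ.arrays 3 i j = if i = x ∧ j = v then (c : ℕ) else σ.arrays 3 i j := by
  intro τ
  set ρ := Cmd.search.den ε σ with hρ
  have hτ : τ = Cmd.record.den ε ρ := rfl
  have ha : ρ.arrays = σ.arrays := funext fun a =>
    Cmd.arrays_den ε Cmd.search σ (a := a) (show a ∉ [] from List.not_mem_nil)
  have e8 : ρ.vars 8 = x := (Cmd.vars_den ε Cmd.search σ (by decide)).trans hx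
  have e10 : ρ.vars 10 = v := (Cmd.vars_den ε Cmd.search σ (by decide)).trans hv
  rw [Cmd.record, Cmd.den_when] at hτ
  rcases search_spec (ε := ε) h hx hq hv hd hH with ⟨h1, h2⟩ | ⟨c, h1, h2, h3⟩
  · rw [if_pos (by simpa [Expr.eval] using h1)] at hτ
    refine Or.inl ⟨h2, fun u w => ?_, ?_⟩
    · rw [hτ, ha]; exact hH u w
    · rw [hτ, ha]
  · rw [if_neg (by simp only [Expr.eval]; rw [h1]; omega)] at hτ
    have h1' : ρ.vars 12 - 1 = c := by rw [h1]; rfl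
    refine Or.inr ⟨c, h2, h3, holds_insert hH fun i j => ?_, fun i j => ?_⟩
    · rw [hτ]
      simp only [Cmd.den_seq, Cmd.den_write, Expr.eval, State.vars_setEntry, e8, e10, h1',
        State.arrays_setEntry, ha, true_and, Fin.ext_iff]
      split_ifs <;> first | rfl | omega
    · rw [hτ]
      simp only [Cmd.den_seq, Cmd.den_write, Expr.eval, State.vars_setEntry, e8, e10, h1',
        State.arrays_setEntry, ha, true_and]
      split_ifs <;> first | rfl | omega

/-- The invariant `I` is left abstract because the routine has two uses: building the tree, where
vertices are counted, and treating an edge, where `I` is `Certified`. -/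
theorem protect_spec {σ : State} (h : Env G s σ) {x q : Fin n} (hx : σ.vars 8 = x)
    (hq : σ.vars 20 = q) (hrow : ∀ v : Fin n, σ.arrays 4 0 v = 0)
    {H : Set (Sym2 (Fin n))} (hH : σ.Holds 1 H) (I : Set (Sym2 (Fin n)) → Prop) (hI : I H)
    (hins : ∀ (H : Set (Sym2 (Fin n))) (c v : Fin n), I H → Sat G s s(q, x) c v →
      (∀ u, Sat G s s(q, x) u v → s(u, v) ∉ H) → I (insert s(c, v) H)) :
    let τ := Cmd.protect.den ε σ
    (∀ v : Fin n, τ.arrays 4 0 v = 0) ∧ (∀ i j, i ≠ x → τ.arrays 3 i j = σ.arrays 3 i j) ∧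
    ∃ H', τ.Holds 1 H' ∧ I H' ∧ H ⊆ H' ∧ ∀ v : Fin n,
      ((∀ u, ¬ Sat G s s(q, x) u v) → τ.arrays 3 x v = σ.arrays 3 x v) ∧
      ((∃ u, Sat G s s(q, x) u v) →
        ∃ c : Fin n, Sat G s s(q, x) c v ∧ s(c, v) ∈ H' ∧ τ.arrays 3 x v = c) := by
  intro τ
  set ρ := Cmd.distances.den ε σ with hρ
  have hτ : τ = (Cmd.loop 10 (Cmd.seq Cmd.search Cmd.record)).den ε ρ := rfl
  have hE : Env G s ρ := h.den _ (by decide) (by decide) (by decide)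
  have hds := distances_spec (ε := ε) h hx hq hrow
  have e8 : ρ.vars 8 = x := (Cmd.vars_den ε Cmd.distances σ (by decide)).trans hx
  have e20 : ρ.vars 20 = q := (Cmd.vars_den ε Cmd.distances σ (by decide)).trans hq
  have a1 : ρ.arrays 1 = σ.arrays 1 := Cmd.arrays_den ε Cmd.distances σ (by decide)
  have a3 : ρ.arrays 3 = σ.arrays 3 := Cmd.arrays_den ε Cmd.distances σ (by decide)
  have a4 : τ.arrays 4 = ρ.arrays 4 := Cmd.arrays_den ε _ ρ (by decide)
  have key := Cmd.loop_induct (ε := ε) (x := 10) (σ := ρ) (P := Cmd.seq Cmd.search Cmd.record)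
    (fun i τ => (∀ i j, i ≠ x → τ.arrays 3 i j = σ.arrays 3 i j) ∧
      ∃ H', τ.Holds 1 H' ∧ I H' ∧ H ⊆ H' ∧ ∀ v : Fin n,
        ((i ≤ v ∨ ∀ u, ¬ Sat G s s(q, x) u v) → τ.arrays 3 x v = σ.arrays 3 x v) ∧
        ((v : ℕ) < i → (∃ u, Sat G s s(q, x) u v) →
          ∃ c : Fin n, Sat G s s(q, x) c v ∧ s(c, v) ∈ H' ∧ τ.arrays 3 x v = c))
    ⟨fun i j _ => by rw [State.arrays_setVar, a3], H, fun u w => by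
      rw [State.arrays_setVar, a1]; exact hH u w, hI, subset_rfl, fun v =>
      ⟨fun _ => by rw [State.arrays_setVar, a3], fun hv => absurd hv (Nat.not_lt_zero _)⟩⟩ ?_
  · rw [hE.size] at key
    obtain ⟨k1, H', k2, k3, k4, k5⟩ := key
    refine ⟨fun v => ?_, k1, H', k2, k3, k4, fun v =>
      ⟨fun hv => (k5 v).1 (Or.inr hv), fun hv => (k5 v).2 v.2 hv⟩⟩
    rw [a4]
    exact (hds v).1
  · rintro i τ hi hτi hτv hτa ⟨k1, H', k2, k3, k4, k5⟩
    rw [hE.size] at hi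
    set v : Fin n := ⟨i, hi⟩ with hv
    have hE' : Env G s τ := hE.congr (hτv 0 (by decide)) (hτv 1 (by decide)) (hτa 0 (by decide))
    have b4 : τ.arrays 4 = ρ.arrays 4 := hτa 4 (by decide)
    have hsp := protect_entry_spec (ε := ε) hE' (v := v) ((hτv 8 (by decide)).trans e8)
      ((hτv 20 (by decide)).trans e20) hτi (fun w => by rw [b4]; exact (hds w).2) k2
    rcases hsp with ⟨s1, s2, s3⟩ | ⟨c, s1, s2, s3, s4⟩
    · refine ⟨fun i j hij => ?_, H', s2, k3, k4, fun w => ⟨fun hw => ?_, fun hw hu => ?_⟩⟩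
      · rw [State.arrays_setVar, s3]
        exact k1 i j hij
      · rw [State.arrays_setVar, s3]
        refine (k5 w).1 (hw.imp (fun h => by omega) id)
      · rw [State.arrays_setVar, s3]
        rcases Fin.lt_succ_cases hi hw with hw | rfl
        · exact (k5 w).2 hw hu
        · obtain ⟨u, hu⟩ := hu
          exact absurd hu (s1 u)
    · refine ⟨fun i j hij => ?_, insert s(c, v) H', s3, ?_, k4.trans (Set.subset_insert _ _),
        fun w => ⟨fun hw => ?_, fun hw hu => ?_⟩⟩
      · rw [State.arrays_setVar, s4, if_neg fun h => hij (Fin.ext h.1)]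
        exact k1 i j hij
      -- Since the search prefers edges of `H'`, a result outside `H'` shows that no edge of `H'`
      -- serves, as `hins` requires.
      · by_cases hc : s(c, v) ∈ H'
        · rwa [Set.insert_eq_of_mem hc]
        · exact hins H' c v k3 s1 fun u hu hm => hc (s2 ⟨u, hu, hm⟩)
      · have hwv : w ≠ v := by
          rintro rfl
          rcases hw with hw | hw
          · simp only [hv] at hw; omega
          · exact hw c s1
        rw [State.arrays_setVar, s4, if_neg fun h => hwv (Fin.ext h.2)]
        exact (k5 w).1 (hw.imp (fun h => by omega) id)
      · rw [State.arrays_setVar, s4]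
        rcases Fin.lt_succ_cases hi hw with hw | rfl
        · rw [if_neg fun h => by simp only [hv] at h; omega]
          obtain ⟨c', hc1, hc2, hc3⟩ := (k5 w).2 hw hu
          exact ⟨c', hc1, Set.mem_insert_of_mem _ hc2, hc3⟩
        · exact ⟨c, s1, Set.mem_insert _ _, if_pos ⟨rfl, rfl⟩⟩

theorem deleteEdges_diag (G : SimpleGraph (Fin n)) (v : Fin n) : G.deleteEdges {s(v, v)} = G := by
  rw [SimpleGraph.deleteEdges_eq_self, Set.disjoint_singleton_right]
  exact fun h => G.loopless.irrefl v h

/-- Deleting the loop `s(s, s)` changes nothing, so `protect` run on it finds last edges of shortest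
paths in `G`, that is, parents. Row `s` of array `3` is first filled with the identity, which makes
the root and the unreachable vertices fixed points. -/
theorem tree_spec {σ : State} (h : Env G s σ) (h4 : ∀ v : Fin n, σ.arrays 4 0 v = 0)
    (h1 : σ.Holds 1 (∅ : Set (Sym2 (Fin n)))) :
    let τ := Cmd.tree.den ε σ
    (∀ v : Fin n, τ.arrays 4 0 v = 0) ∧ ∃ (p : Fin n → Fin n) (H : Set (Sym2 (Fin n))),
      IsParent G s p ∧ (∀ v : Fin n, τ.arrays 3 s v = p v) ∧ τ.Holds 1 H ∧ H ⊆ G.edgeSet ∧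
      H.ncard ≤ n ∧ ∀ v, p v ≠ v → s(p v, v) ∈ H := by
  classical
  intro τ
  set ρ₁ := (Cmd.loop 10 (.write 3 (.var 1) (.var 10) (.var 10))).den ε σ with hρ₁
  have hself : ∀ v : Fin n, ρ₁.arrays 3 s v = v := by
    have key := Cmd.loop_induct (ε := ε) (x := 10) (σ := σ)
      (P := .write 3 (.var 1) (.var 10) (.var 10))
      (fun i τ => ∀ v : Fin n, (v : ℕ) < i → τ.arrays 3 s v = v)
      (fun v hv => absurd hv (Nat.not_lt_zero _)) ?_
    · rw [h.size] at key
      exact fun v => key v v.2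
    · intro i τ hi hτi hτv hτa hI v hv
      have e1 := (hτv 1 (by decide)).trans h.source
      rw [State.arrays_setVar, Cmd.den_write, State.arrays_setEntry]
      simp only [Expr.eval, hτi, e1]
      split_ifs with hc
      · exact hc.2.2.symm
      · exact hI v (by simp only [true_and] at hc; omega)
  have hE₁ : Env G s ρ₁ := h.den _ (by decide) (by decide) (by decide)
  set ρ := (Cmd.assign 20 (.var 1)).den ε ((Cmd.assign 8 (.var 1)).den ε ρ₁) with hρ
  have hτ : τ = Cmd.protect.den ε ρ := rfl
  have hE : Env G s ρ := hE₁.congr rfl rfl rfl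
  have e8 : ρ.vars 8 = s := hE₁.source
  have e20 : ρ.vars 20 = s := hE₁.source
  have b4 : ρ.arrays 4 = σ.arrays 4 := Cmd.arrays_den ε _ σ (by decide)
  have b1 : ρ.arrays 1 = σ.arrays 1 := Cmd.arrays_den ε _ σ (by decide)
  have b3 : ρ.arrays 3 = ρ₁.arrays 3 := rfl
  have hsat : ∀ u v, Sat G s s(s, s) u v ↔ G.Adj u v ∧ cdist G s u + 1 = cdist G s v := by
    intro u v
    rw [Sat, deleteEdges_diag]
  -- The set `Y` consists of vertices already served by an edge of `H`. Every insertion adds a new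
  -- vertex to it, so at most `n` edges are inserted.
  obtain ⟨k1, -, H', k3, ⟨Y, k4, k4', k4''⟩, -, k5⟩ := protect_spec (ε := ε) hE e8 e20
    (fun v => by rw [b4]; exact h4 v) (H := ∅) (fun u v => by rw [b1]; exact h1 u v)
    (fun H => ∃ Y : Finset (Fin n), H.ncard ≤ Y.card ∧ H ⊆ G.edgeSet ∧
      ∀ v ∈ Y, ∃ u, Sat G s s(s, s) u v ∧ s(u, v) ∈ H)
    ⟨∅, by simp, Set.empty_subset _, by simp⟩ (by
      rintro H c v ⟨Y, y1, y2, y3⟩ hc hH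
      have hv : v ∉ Y := fun hv => by
        obtain ⟨u, hu, hm⟩ := y3 v hv
        exact hH u hu hm
      refine ⟨insert v Y, ?_, Set.insert_subset ((hsat c v).1 hc).1 y2, fun w hw => ?_⟩
      · rw [Finset.card_insert_of_notMem hv]
        exact (Set.ncard_insert_le _ _).trans (Nat.add_le_add_right y1 1)
      · rcases Finset.mem_insert.1 hw with rfl | hw
        · exact ⟨c, hc, Set.mem_insert _ _⟩
        · obtain ⟨u, hu, hm⟩ := y3 w hw
          exact ⟨u, hu, Set.mem_insert_of_mem _ hm⟩)
  refine ⟨k1, ?_⟩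
  have hex : ∀ v : Fin n, ∃ c : Fin n, (Cmd.protect.den ε ρ).arrays 3 s v = c ∧
      ((∃ u, Sat G s s(s, s) u v) → Sat G s s(s, s) c v ∧ s(c, v) ∈ H') ∧
      (¬ (∃ u, Sat G s s(s, s) u v) → c = v) := by
    intro v
    by_cases hv : ∃ u, Sat G s s(s, s) u v
    · obtain ⟨c, hc1, hc2, hc3⟩ := (k5 v).2 hv
      exact ⟨c, hc3, fun _ => ⟨hc1, hc2⟩, fun hn => absurd hv hn⟩
    · refine ⟨v, ?_, fun hv' => absurd hv' hv, fun _ => rfl⟩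
      rw [(k5 v).1 (not_exists.1 hv), b3, hself]
  choose p hp1 hp2 hp3 using hex
  have hpsat : ∀ v, p v ≠ v → Sat G s s(s, s) (p v) v ∧ s(p v, v) ∈ H' := by
    intro v hv
    exact hp2 v (by_contra fun hn => hv (hp3 v hn))
  refine ⟨p, H', ⟨?_, fun v hv => ((hsat _ _).1 (hpsat v hv).1).1, fun v hv =>
    ((hsat _ _).1 (hpsat v hv).1).2, fun v hv hlt => ?_⟩, hp1, k3, k4', ?_, fun v hv =>
    (hpsat v hv).2⟩
  · by_contra hs
    exact (hpsat s hs).1.ne_root rfl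
  · obtain ⟨c, hc1, hc2⟩ := exists_adj_tdist hv hlt
    exact ((hsat _ _).1 (hp2 v ⟨c, (hsat c v).2 ⟨hc1, hc2⟩⟩).1).1.ne
  · exact k4.trans ((Finset.card_le_univ Y).trans_eq (Fintype.card_fin n))

end Protect

/-! ### Correctness of the density test, of the treatment of the tree edges and of the threshold. -/

section Main

variable {n : ℕ} {G : SimpleGraph (Fin n)} {s : Fin n} {ε : ℝ} {p : Fin n → Fin n}

theorem ncard_lt_succ {i : ℕ} (hi : i < n) (P : Fin n → Prop) [Decidable (P ⟨i, hi⟩)] :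
    {w : Fin n | (w : ℕ) < i + 1 ∧ P w}.ncard =
      {w : Fin n | (w : ℕ) < i ∧ P w}.ncard + if P ⟨i, hi⟩ then 1 else 0 := by
  split_ifs with h
  · rw [← Set.ncard_insert_of_notMem (a := (⟨i, hi⟩ : Fin n)) (by simp) (Set.toFinite _)]
    congr 1
    ext w
    constructor
    · rintro ⟨h1, h2⟩
      rcases Fin.lt_succ_cases hi h1 with h1 | rfl
      · exact Or.inr ⟨h1, h2⟩
      · exact Or.inl rfl
    · rintro (rfl | ⟨h1, h2⟩)
      · exact ⟨Nat.lt_succ_self i, h⟩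
      · exact ⟨by omega, h2⟩
  · rw [add_zero]
    congr 1
    ext w
    constructor
    · rintro ⟨h1, h2⟩
      rcases Fin.lt_succ_cases hi h1 with h1 | rfl
      · exact ⟨h1, h2⟩
      · exact absurd h2 h
    · rintro ⟨h1, h2⟩
      exact ⟨by omega, h2⟩

/-- Each `w` climbs `n` steps along `p`, and its stop after `j` steps increments one entry of column
`j`. Fixed points keep being counted, in agreement with the iterates in `Dense`. -/
theorem countDescendants_spec {σ : State} (h : Env G s σ)
    (hp : ∀ v : Fin n, σ.arrays 3 s v = p v) (h5 : ∀ (x : Fin n) (j : ℕ), σ.arrays 5 x j = 0)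
    (x : Fin n) {j : ℕ} (hj : j < n) :
    (Cmd.countDescendants.den ε σ).arrays 5 x j = {w | p^[j] w = x}.ncard := by
  have key := Cmd.loop_induct (ε := ε) (x := 13) (σ := σ) (P := (Cmd.assign 15 (.var 13)).seq
      (Cmd.loop 14 (Cmd.seq
      (.write 5 (.var 15) (.var 14) (.add (.read 5 (.var 15) (.var 14)) (.const 1)))
      (.assign 15 (.read 3 (.var 1) (.var 15))))))
    (fun i τ => ∀ (x : Fin n) (j : ℕ), j < n → τ.arrays 5 x j =
      {w : Fin n | (w : ℕ) < i ∧ p^[j] w = x}.ncard)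
    (fun x j _ => by simp [State.arrays_setVar, h5]) ?_
  · rw [h.size] at key
    rw [Cmd.countDescendants, key x j hj]
    congr 1
    ext w
    simp
  · intro i τ hi hτi hτv hτa hI
    rw [h.size] at hi
    set w : Fin n := ⟨i, hi⟩ with hw
    rw [Cmd.den_seq]
    set ρ := (Cmd.assign 15 (.var 13)).den ε τ with hρ
    have hρv : ∀ y, y ≠ 15 → ρ.vars y = τ.vars y := fun y hy => by
      rw [hρ, Cmd.den_assign, State.vars_setVar, if_neg hy]
    have e0 : ρ.vars 0 = n := (hρv 0 (by decide)).trans ((hτv 0 (by decide)).trans h.size)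
    have e1 : ρ.vars 1 = s := (hρv 1 (by decide)).trans ((hτv 1 (by decide)).trans h.source)
    have e15 : ρ.vars 15 = w := by
      rw [hρ, Cmd.den_assign, State.vars_setVar, if_pos rfl, Expr.eval, hτi]
    have b3 : ρ.arrays 3 = σ.arrays 3 := hτa 3 (by decide)
    have b5 : ρ.arrays 5 = τ.arrays 5 := rfl
    have key2 := Cmd.loop_induct (ε := ε) (x := 14) (σ := ρ) (P := Cmd.seq
        (.write 5 (.var 15) (.var 14) (.add (.read 5 (.var 15) (.var 14)) (.const 1)))
        (.assign 15 (.read 3 (.var 1) (.var 15))))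
      (fun j' τ' => τ'.vars 15 = (p^[j'] w : Fin n) ∧ ∀ (x : Fin n) (j : ℕ), j < n →
        τ'.arrays 5 x j = τ.arrays 5 x j + if j < j' ∧ p^[j] w = x then 1 else 0)
      ⟨by rw [State.vars_setVar, if_neg (by decide), e15]; rfl,
        fun x j _ => by simp [State.arrays_setVar, b5]⟩ ?_
    · rw [e0] at key2
      intro x j hj
      rw [State.arrays_setVar, key2.2 x j hj, hI x j hj, ncard_lt_succ hi]
      simp [hj, hw]
    · rintro j' τ' hj' hτ'j hτ'v hτ'a ⟨k1, k2⟩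
      have f1 : τ'.vars 1 = s := (hτ'v 1 (by decide)).trans e1
      have f3 : τ'.arrays 3 = σ.arrays 3 := (hτ'a 3 (by decide)).trans b3
      refine ⟨?_, fun x j hj => ?_⟩
      · rw [State.vars_setVar, if_neg (by decide), Cmd.den_seq, Cmd.den_assign, State.vars_setVar,
          if_pos rfl, Cmd.den_write]
        simp only [Expr.eval, State.vars_setEntry, State.arrays_setEntry, f1, k1]
        rw [if_neg (by simp), f3, hp, Function.iterate_succ_apply']
      · rw [State.arrays_setVar, Cmd.den_seq, Cmd.den_assign, State.arrays_setVar, Cmd.den_write]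
        simp only [Expr.eval, State.arrays_setEntry, k1, hτ'j]
        rw [e0] at hj'
        by_cases hc : x = p^[j'] w ∧ j = j'
        · obtain ⟨rfl, rfl⟩ := hc
          rw [if_pos ⟨trivial, rfl, rfl⟩, k2 _ _ hj]
          simp
        · rw [if_neg (by rw [← Fin.ext_iff]; tauto), k2 x j hj]
          congr 1
          refine if_congr ?_ rfl rfl
          constructor
          · rintro ⟨h1, h2⟩
            exact ⟨by omega, h2⟩
          · rintro ⟨h1, h2⟩
            refine ⟨lt_of_le_of_ne (by omega) ?_, h2⟩
            rintro rfl
            exact hc ⟨h2.symm, rfl⟩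

theorem testDense_spec {σ : State} (h : Env G s σ) {x : Fin n} (hx : σ.vars 8 = x) {K : ℕ}
    (hK : σ.vars 6 = K)
    (h5 : ∀ (x : Fin n) (j : ℕ), j < n → σ.arrays 5 x j = {w | p^[j] w = x}.ncard) :
    (Cmd.testDense.den ε σ).vars 19 ≠ 0 ↔ Dense p K x := by
  simp only [Cmd.testDense, Cmd.den_seq]
  set ρ := (Cmd.assign 19 (.const 0)).den ε ((Cmd.assign 18 (.const 0)).den ε
    ((Cmd.assign 17 (.const 0)).den ε σ)) with hρ
  have hρv : ∀ y, y ≠ 17 → y ≠ 18 → y ≠ 19 → ρ.vars y = σ.vars y := fun y h1 h2 h3 => by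
    simp [hρ, Cmd.den_assign, State.vars_setVar, h1, h2, h3]
  have e0 : ρ.vars 0 = n := (hρv 0 (by decide) (by decide) (by decide)).trans h.size
  have e6 : ρ.vars 6 = K := (hρv 6 (by decide) (by decide) (by decide)).trans hK
  have e8 : ρ.vars 8 = x := (hρv 8 (by decide) (by decide) (by decide)).trans hx
  have key := Cmd.loop_induct (ε := ε) (x := 16) (σ := ρ)
    (P := (Cmd.assign 17 (.add (.var 17) (.read 5 (.var 8) (.var 16)))).seq
      ((Cmd.assign 18 (.add (.var 18) (.var 6))).seq
      (Cmd.when (.sub (.const 1) (.sub (.var 18) (.var 17))) (.assign 19 (.const 1)))))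
    (fun i τ => τ.vars 17 = ∑ j ∈ Finset.range i, {w | p^[j] w = x}.ncard ∧
      τ.vars 18 = K * i ∧ (τ.vars 19 ≠ 0 ↔ ∃ L < i, K * (L + 1) ≤
        ∑ j ∈ Finset.range (L + 1), {w | p^[j] w = x}.ncard))
    ⟨by simp [hρ, Cmd.den_assign, State.vars_setVar, Expr.eval],
      by simp [hρ, Cmd.den_assign, State.vars_setVar, Expr.eval],
      by simp [hρ, Cmd.den_assign, State.vars_setVar, Expr.eval]⟩ ?_
  · rw [e0] at key
    rw [key.2.2, Dense, Fintype.card_fin]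
  · rintro i τ hi hτi hτv hτa ⟨k1, k2, k3⟩
    rw [e0] at hi
    have f6 := (hτv 6 (by decide)).trans e6
    have f8 := (hτv 8 (by decide)).trans e8
    have b5 : τ.arrays 5 = σ.arrays 5 := hτa 5 (by decide)
    have hS : (∑ j ∈ Finset.range i, {w | p^[j] w = x}.ncard) + τ.arrays 5 x i =
        ∑ j ∈ Finset.range (i + 1), {w | p^[j] w = x}.ncard := by
      rw [Finset.sum_range_succ, b5, h5 x i hi]
    have hKi : K * i + K = K * (i + 1) := by ring
    have hlast : (∃ L < i + 1, K * (L + 1) ≤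
        ∑ j ∈ Finset.range (L + 1), {w | p^[j] w = x}.ncard) ↔
        K * (i + 1) ≤ ∑ j ∈ Finset.range (i + 1), {w | p^[j] w = x}.ncard ∨
        ∃ L < i, K * (L + 1) ≤ ∑ j ∈ Finset.range (L + 1), {w | p^[j] w = x}.ncard := by
      constructor
      · rintro ⟨L, hL, h⟩
        rcases Nat.lt_succ_iff_lt_or_eq.1 hL with hL | rfl
        · exact Or.inr ⟨L, hL, h⟩
        · exact Or.inl h
      · rintro (h | ⟨L, hL, h⟩)
        · exact ⟨i, Nat.lt_succ_self i, h⟩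
        · exact ⟨L, by omega, h⟩
    simp only [Cmd.den_seq, Cmd.den_when, Cmd.den_assign, Expr.eval]
    simp only [State.vars_setVar, k1, k2, f6, f8, hτi, hS, hKi, hlast,
      Nat.reduceEqDiff, if_true, if_false]
    split_ifs with hc
    · refine ⟨?_, ?_, ?_⟩
      · simp [State.vars_setVar]
      · simp [State.vars_setVar]
      · have hn : ¬ K * (i + 1) ≤ ∑ j ∈ Finset.range (i + 1), {w | p^[j] w = x}.ncard := by omega
        simp only [State.vars_setVar, Nat.reduceEqDiff, if_false, hn,
          false_or]
        exact k3
    · refine ⟨?_, ?_, ?_⟩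
      · simp [State.vars_setVar]
      · simp [State.vars_setVar]
      · have hn : K * (i + 1) ≤ ∑ j ∈ Finset.range (i + 1), {w | p^[j] w = x}.ncard := by omega
        simp [State.vars_setVar, hn]

theorem treatEdges_spec {σ : State} (h : Env G s σ) (hp : IsParent G s p)
    (h3 : ∀ v : Fin n, σ.arrays 3 s v = p v) (h4 : ∀ v : Fin n, σ.arrays 4 0 v = 0) {K : ℕ}
    (hK : σ.vars 6 = K)
    (h5 : ∀ (x : Fin n) (j : ℕ), j < n → σ.arrays 5 x j = {w | p^[j] w = x}.ncard)
    {H₀ : Set (Sym2 (Fin n))} (h1 : σ.Holds 1 H₀) (hH₀ : H₀ ⊆ G.edgeSet)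
    (htree : ∀ v, p v ≠ v → s(p v, v) ∈ H₀) (h2 : σ.Holds 2 (∅ : Set (Sym2 (Fin n)))) :
    ∃ H, (Cmd.treatEdges.den ε σ).Holds 1 H ∧ Certified G s p K H₀ H ∧ Complete G s p K H ∧
      (Cmd.treatEdges.den ε σ).Holds 2 (denseEdges p K) := by
  have key := Cmd.loop_induct (ε := ε) (x := 8) (σ := σ)
    (P := (Cmd.assign 20 (.read 3 (.var 1) (.var 8))).seq (Cmd.when (.absDiff (.var 20) (.var 8))
      (Cmd.testDense.seq (.ite (.var 19) Cmd.reinforce Cmd.protect))))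
    (fun i τ => (∀ v : Fin n, τ.arrays 3 s v = p v) ∧ (∀ v : Fin n, τ.arrays 4 0 v = 0) ∧
      τ.Holds 2 {e | ∃ x : Fin n, (x : ℕ) < i ∧ p x ≠ x ∧ Dense p K x ∧ e = s(p x, x)} ∧
      ∃ H, τ.Holds 1 H ∧ Certified G s p K H₀ H ∧ ∀ x : Fin n, (x : ℕ) < i → p x ≠ x →
        ¬ Dense p K x → ∀ v, (∃ u, Sat G s s(p x, x) u v) →
          ∃ u, Sat G s s(p x, x) u v ∧ s(u, v) ∈ H)
    ⟨h3, h4, by simpa using show (σ.setVar 8 0).Holds 2 ∅ from h2, H₀, h1, Certified.refl hH₀,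
      fun x hx => absurd hx (Nat.not_lt_zero _)⟩ ?_
  · rw [h.size] at key
    obtain ⟨-, -, k3, H, k4, k5, k6⟩ := key
    refine ⟨H, k4, k5, fun x => k6 x x.2, ?_⟩
    have : {e | ∃ x : Fin n, (x : ℕ) < n ∧ p x ≠ x ∧ Dense p K x ∧ e = s(p x, x)} =
        denseEdges p K := by
      ext e
      simp [denseEdges]
    exact this ▸ k3
  · rintro i τ hi hτi hτv hτa ⟨k1, k2, k3, H, k4, k5, k6⟩
    rw [h.size] at hi
    set x : Fin n := ⟨i, hi⟩ with hx
    have hE : Env G s τ := h.congr (hτv 0 (by decide)) (hτv 1 (by decide)) (hτa 0 (by decide))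
    rw [Cmd.den_seq]
    set ρ := (Cmd.assign 20 (.read 3 (.var 1) (.var 8))).den ε τ with hρ
    have hρv : ∀ y, y ≠ 20 → ρ.vars y = τ.vars y := fun y hy => by
      rw [hρ, Cmd.den_assign, State.vars_setVar, if_neg hy]
    have hρa : ρ.arrays = τ.arrays := rfl
    have e20 : ρ.vars 20 = p x := by
      rw [hρ, Cmd.den_assign, State.vars_setVar, if_pos rfl, Expr.eval, Expr.eval, Expr.eval,
        hE.source, hτi]
      exact k1 x
    have e8 : ρ.vars 8 = x := (hρv 8 (by decide)).trans hτi
    have e6 : ρ.vars 6 = K := (hρv 6 (by decide)).trans ((hτv 6 (by decide)).trans hK)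
    have hEρ : Env G s ρ := hE.congr (hρv 0 (by decide)) (hρv 1 (by decide)) rfl
    rw [Cmd.den_when]
    have hskip : (p x = x ∨ Dense p K x) → ∀ x : Fin n, (x : ℕ) < i + 1 → p x ≠ x →
        ¬ Dense p K x → ∀ v, (∃ u, Sat G s s(p x, x) u v) →
          ∃ u, Sat G s s(p x, x) u v ∧ s(u, v) ∈ H := by
      intro hor y hy hy1 hy2
      rcases Fin.lt_succ_cases hi hy with hy | rfl
      · exact k6 y hy hy1 hy2
      · exact absurd hor (not_or.2 ⟨hy1, hy2⟩)
    have hsame : (p x = x ∨ ¬ Dense p K x) →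
        {e | ∃ x : Fin n, (x : ℕ) < i + 1 ∧ p x ≠ x ∧ Dense p K x ∧ e = s(p x, x)} =
        {e | ∃ x : Fin n, (x : ℕ) < i ∧ p x ≠ x ∧ Dense p K x ∧ e = s(p x, x)} := by
      intro hor
      ext e
      constructor
      · rintro ⟨y, hy, hy1, hy2, rfl⟩
        rcases Fin.lt_succ_cases hi hy with hy | rfl
        · exact ⟨y, hy, hy1, hy2, rfl⟩
        · exact absurd hor (not_or.2 ⟨hy1, not_not.2 hy2⟩)
      · rintro ⟨y, hy, hy1⟩
        exact ⟨y, by omega, hy1⟩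
    split_ifs with hA
    · rw [Expr.eval_absDiff_eq_zero] at hA
      simp only [Expr.eval, e20, e8] at hA
      have hpx : p x = x := Fin.ext hA
      refine ⟨k1, k2, ?_, H, k4, k5, hskip (Or.inl hpx)⟩
      rw [hsame (Or.inl hpx)]
      exact k3
    · have hpx : p x ≠ x := by
        intro hpx
        refine hA (Expr.eval_absDiff_eq_zero.2 ?_)
        simp only [Expr.eval, e20, e8, hpx]
      rw [Cmd.den_seq]
      set π := Cmd.testDense.den ε ρ with hπ
      have hdense : π.vars 19 ≠ 0 ↔ Dense p K x :=
          testDense_spec (ε := ε) hEρ e8 e6 (fun y j hj => by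
        have b5 : ρ.arrays 5 = σ.arrays 5 := hτa 5 (by decide)
        rw [b5]
        exact h5 y j hj)
      have hπa : π.arrays = τ.arrays := funext fun a =>
        Cmd.arrays_den ε Cmd.testDense ρ (a := a) (show a ∉ [] from List.not_mem_nil)
      have f8 : π.vars 8 = x := (Cmd.vars_den ε Cmd.testDense ρ (by decide)).trans e8
      have f20 : π.vars 20 = p x := (Cmd.vars_den ε Cmd.testDense ρ (by decide)).trans e20
      have hEπ : Env G s π := hEρ.den _ (by decide) (by decide) (by decide)
      rw [Cmd.den_ite]
      split_ifs with hB
      · have hnd : ¬ Dense p K x := fun hd => hdense.2 hd hB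
        -- The tree is stored in row `s` of array `3`, and treating `x` overwrites row `x`. The root
        -- is a fixed point of `p`, so the tree is safe.
        have hps : s ≠ x := by
          intro hs
          exact hpx (hs ▸ hp.root)
        obtain ⟨r1, r2, H', r3, r4, r5, r6⟩ := protect_spec (ε := ε) hEπ f8 f20
          (fun v => by rw [hπa]; exact k2 v) (H := H) (fun u v => by rw [hπa]; exact k4 u v)
          (fun H => Certified G s p K H₀ H) k5
          (fun H c v hH hc hn => hH.insert htree hpx hnd hc hn)
        have b2 : (Cmd.protect.den ε π).arrays 2 = τ.arrays 2 :=
          (Cmd.arrays_den ε Cmd.protect π (by decide)).trans (by rw [hπa])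
        refine ⟨fun v => ?_, r1, ?_, H', r3, r4, fun y hy hy1 hy2 v hv => ?_⟩
        · rw [State.arrays_setVar, r2 s v hps, hπa]
          exact k1 v
        · rw [hsame (Or.inr hnd)]
          intro u v
          rw [State.arrays_setVar, b2]
          exact k3 u v
        · rcases Fin.lt_succ_cases hi hy with hy | rfl
          · obtain ⟨u, hu, hm⟩ := k6 y hy hy1 hy2 v hv
            exact ⟨u, hu, r5 hm⟩
          · obtain ⟨c, hc, hm, -⟩ := (r6 v).2 hv
            exact ⟨c, hc, hm⟩
      · have hd : Dense p K x := hdense.1 hB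
        have hset : {e | ∃ x : Fin n, (x : ℕ) < i + 1 ∧ p x ≠ x ∧ Dense p K x ∧
            e = s(p x, x)} = insert s(p x, x)
            {e | ∃ x : Fin n, (x : ℕ) < i ∧ p x ≠ x ∧ Dense p K x ∧ e = s(p x, x)} := by
          ext e
          constructor
          · rintro ⟨y, hy, hy1, hy2, rfl⟩
            rcases Fin.lt_succ_cases hi hy with hy | rfl
            · exact Or.inr ⟨y, hy, hy1, hy2, rfl⟩
            · exact Or.inl rfl
          · rintro (rfl | ⟨y, hy, hy1⟩)
            · exact ⟨x, Nat.lt_succ_self i, hpx, hd, rfl⟩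
            · exact ⟨y, by omega, hy1⟩
        have hother : ∀ a, a ≠ 2 → (Cmd.reinforce.den ε π).arrays a = τ.arrays a := by
          intro a ha
          rw [Cmd.arrays_den ε Cmd.reinforce π (by simpa [Cmd.reinforce, Cmd.arrays] using ha), hπa]
        refine ⟨fun v => ?_, fun v => ?_, ?_, H, fun u v => ?_, k5, hskip (Or.inr hd)⟩
        · rw [State.arrays_setVar, hother 3 (by decide)]
          exact k1 v
        · rw [State.arrays_setVar, hother 4 (by decide)]
          exact k2 v
        · rw [hset]
          refine holds_insert k3 fun u v => ?_
          rw [State.arrays_setVar, Cmd.reinforce]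
          simp only [Cmd.den_seq, Cmd.den_write, Expr.eval, State.vars_setEntry, f8, f20,
            State.arrays_setEntry, hπa, true_and, Fin.ext_iff]
          split_ifs <;> first | rfl | omega
        · rw [State.arrays_setVar, hother 1 (by decide)]
          exact k4 u v

theorem computeLog_spec {σ : State} (hn : 0 < n) (h : σ.vars 0 = n) :
    (Cmd.computeLog.den ε σ).vars 2 = Nat.log 2 n := by
  simp only [Cmd.computeLog, Cmd.den_seq]
  set ρ := (Cmd.assign 2 (.const 0)).den ε ((Cmd.assign 3 (.const 1)).den ε σ) with hρ
  have e0 : ρ.vars 0 = n := by simp [hρ, Cmd.den_assign, State.vars_setVar, h]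
  have key := Cmd.loop_induct (ε := ε) (x := 7) (σ := ρ)
    (P := Cmd.when (.sub (.add (.var 0) (.const 1)) (.add (.var 3) (.var 3)))
      ((Cmd.assign 3 (.add (.var 3) (.var 3))).seq (.assign 2 (.add (.var 2) (.const 1)))))
    (fun i τ => τ.vars 3 = 2 ^ τ.vars 2 ∧ 2 ^ τ.vars 2 ≤ n ∧
      (τ.vars 2 = i ∨ n < 2 ^ (τ.vars 2 + 1)))
    ⟨by simp [hρ, Cmd.den_assign, State.vars_setVar, Expr.eval],
      by simp [hρ, Cmd.den_assign, State.vars_setVar, Expr.eval]; omega,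
      by simp [hρ, Cmd.den_assign, State.vars_setVar, Expr.eval]⟩ ?_
  · rw [e0] at key
    obtain ⟨-, k2, k3⟩ := key
    -- The exponent cannot have grown in all `n` rounds, because `n < 2 ^ n`.
    refine (Nat.log_eq_of_pow_le_of_lt_pow k2 (k3.resolve_left fun h => ?_)).symm
    rw [h] at k2
    exact absurd k2 (not_le.2 Nat.lt_two_pow_self)
  · rintro i τ hi hτi hτv hτa ⟨k1, k2, k3⟩
    have f0 : τ.vars 0 = n := (hτv 0 (by decide)).trans e0
    have hpow : 2 ^ (τ.vars 2 + 1) = 2 ^ τ.vars 2 + 2 ^ τ.vars 2 := by ring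
    rw [Cmd.den_when]
    simp only [Expr.eval, f0, k1]
    split_ifs with hc
    · simp only [State.vars_setVar, Nat.reduceEqDiff, if_false]
      exact ⟨k1, k2, Or.inr (by omega)⟩
    · simp only [Cmd.den_seq, Cmd.den_assign, Expr.eval, State.vars_setVar,
        Nat.reduceEqDiff, if_false, if_true, k1, hpow]
      refine ⟨trivial, by omega, ?_⟩
      rcases k3 with k3 | k3
      · exact Or.inl (by omega)
      · omega

/-- The exponent is increased until it reaches `ε * a`; `n` rounds suffice because `ε * a ≤ a ≤ n`.
-/
theorem computePow_spec {σ : State} (h : σ.vars 0 = n) {a : ℕ} (ha : σ.vars 2 = a) (han : a ≤ n)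
    (hε : 0 < ε) (hε1 : ε ≤ 1) :
    ∃ m : ℕ, (Cmd.computePow.den ε σ).vars 5 = 2 ^ m ∧ ε * a ≤ m ∧ (m : ℝ) < ε * a + 1 := by
  simp only [Cmd.computePow, Cmd.den_seq]
  set ρ := (Cmd.assign 4 (.const 0)).den ε ((Cmd.assign 5 (.const 1)).den ε σ) with hρ
  have e0 : ρ.vars 0 = n := by simp [hρ, Cmd.den_assign, State.vars_setVar, h]
  have e2 : ρ.vars 2 = a := by simp [hρ, Cmd.den_assign, State.vars_setVar, ha]
  have hpos : 0 ≤ ε * a := by positivity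
  have key := Cmd.loop_induct (ε := ε) (x := 7) (σ := ρ)
    (P := Cmd.ite (.realLe (.var 2) (.var 4)) .skip
      ((Cmd.assign 4 (.add (.var 4) (.const 1))).seq (.assign 5 (.add (.var 5) (.var 5)))))
    (fun i τ => τ.vars 5 = 2 ^ τ.vars 4 ∧ (τ.vars 4 : ℝ) < ε * a + 1 ∧
      (τ.vars 4 = i ∨ ε * a ≤ τ.vars 4))
    ⟨by simp [hρ, Cmd.den_assign, State.vars_setVar, Expr.eval],
      by simp [hρ, Cmd.den_assign, State.vars_setVar, Expr.eval]; linarith,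
      by simp [hρ, Cmd.den_assign, State.vars_setVar, Expr.eval]⟩ ?_
  · rw [e0] at key
    obtain ⟨k1, k2, k3⟩ := key
    refine ⟨_, k1, k3.elim (fun h => ?_) id, k2⟩
    rw [h]
    calc ε * a ≤ 1 * a := mul_le_mul_of_nonneg_right hε1 (Nat.cast_nonneg a)
      _ ≤ n := by rw [one_mul]; exact_mod_cast han
  · rintro i τ hi hτi hτv hτa ⟨k1, k2, k3⟩
    have f2 : τ.vars 2 = a := (hτv 2 (by decide)).trans e2
    rw [Cmd.den_ite]
    simp only [Expr.eval, f2]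
    by_cases hc : ε * (a : ℝ) ≤ τ.vars 4
    · rw [if_pos hc, if_neg one_ne_zero]
      simp only [State.vars_setVar, Nat.reduceEqDiff, if_false]
      exact ⟨k1, k2, Or.inr hc⟩
    · rw [if_neg hc, if_pos rfl]
      have hi' := k3.resolve_right hc
      simp only [Cmd.den_seq, Cmd.den_assign, Expr.eval, State.vars_setVar,
        Nat.reduceEqDiff, if_false, if_true, k1]
      refine ⟨by ring, ?_, Or.inl (by omega)⟩
      push_cast
      linarith [not_le.1 hc]

/-- Multiplication by repeated addition in the rounds `0, …, a`, all of which occur since `a < n`.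
-/
theorem computeThreshold_spec {σ : State} (h : σ.vars 0 = n) {a K : ℕ} (ha : σ.vars 2 = a)
    (han : a < n) (hK : σ.vars 5 = K) (b : Bool) :
    ((Cmd.computeThreshold b).den ε σ).vars 6 = K * if b then a + 1 else 1 := by
  cases b with
  | false => simp [Cmd.computeThreshold, Cmd.den_assign, State.vars_setVar, Expr.eval, hK]
  | true =>
    simp only [Cmd.computeThreshold, Cmd.den_seq, if_true]
    set ρ := (Cmd.assign 6 (.const 0)).den ε σ with hρ
    have e0 : ρ.vars 0 = n := by simp [hρ, Cmd.den_assign, State.vars_setVar, h]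
    have e2 : ρ.vars 2 = a := by simp [hρ, Cmd.den_assign, State.vars_setVar, ha]
    have e5 : ρ.vars 5 = K := by simp [hρ, Cmd.den_assign, State.vars_setVar, hK]
    have key := Cmd.loop_induct (ε := ε) (x := 7) (σ := ρ)
      (P := Cmd.when (.sub (.add (.var 2) (.const 1)) (.var 7))
        (.assign 6 (.add (.var 6) (.var 5))))
      (fun i τ => τ.vars 6 = K * min i (a + 1))
      (by simp [hρ, Cmd.den_assign, State.vars_setVar, Expr.eval]) ?_
    · rw [e0, min_eq_right (by omega)] at key
      exact key
    · rintro i τ hi hτi hτv hτa k1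
      have f2 : τ.vars 2 = a := (hτv 2 (by decide)).trans e2
      have f5 : τ.vars 5 = K := (hτv 5 (by decide)).trans e5
      rw [Cmd.den_when]
      simp only [Expr.eval, f2, hτi]
      split_ifs with hc
      · simp only [State.vars_setVar, Nat.reduceEqDiff, if_false, k1]
        congr 1
        omega
      · simp only [Cmd.den_assign, Expr.eval, State.vars_setVar, Nat.reduceEqDiff,
          if_false, if_true, k1, f5]
        rw [min_eq_left (by omega), min_eq_left (by omega)]
        ring

end Main
/-! ## The bounds -/

section Bounds

variable {n : ℕ} {G : SimpleGraph (Fin n)} {s : Fin n} {ε : ℝ} {p : Fin n → Fin n}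

theorem main_spec (G : SimpleGraph (Fin n)) (s : Fin n) (hε : 0 < ε) (hε1 : ε ≤ 1) (b : Bool) :
    ∃ (p : Fin n → Fin n) (m K : ℕ) (H₀ H : Set (Sym2 (Fin n))), IsParent G s p ∧
      ε * Nat.log 2 n ≤ m ∧ (m : ℝ) < ε * Nat.log 2 n + 1 ∧
      K = 2 ^ m * (if b then Nat.log 2 n + 1 else 1) ∧ H₀.ncard ≤ n ∧
      (∀ v, p v ≠ v → s(p v, v) ∈ H₀) ∧ Certified G s p K H₀ H ∧ Complete G s p K H ∧
      ((Cmd.main b).den ε (inputState G s)).Holds 1 H ∧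
      ((Cmd.main b).den ε (inputState G s)).Holds 2 (denseEdges p K) := by
  have hn : 0 < n := s.pos
  have han : Nat.log 2 n < n := Nat.log_lt_self 2 hn.ne'
  set σ := inputState G s with hσ
  have hE : Env G s σ := by
    classical
    refine ⟨by simp [hσ, inputState], by simp [hσ, inputState], fun u v => ?_⟩
    simp [hσ, inputState]
  have hzero : ∀ a, a ≠ 0 → ∀ i j, σ.arrays a i j = 0 := by
    intro a ha i j
    simp [hσ, inputState, ha]
  set σ₁ := Cmd.computeLog.den ε σ with hσ₁
  set σ₂ := Cmd.computePow.den ε σ₁ with hσ₂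
  set σ₃ := (Cmd.computeThreshold b).den ε σ₂ with hσ₃
  have hE₁ : Env G s σ₁ := hE.den _ (by decide) (by decide) (by decide)
  have hE₂ : Env G s σ₂ := hE₁.den _ (by decide) (by decide) (by decide)
  have hE₃ : Env G s σ₃ := hE₂.den _ (by cases b <;> decide) (by cases b <;> decide)
    (by cases b <;> decide)
  have ha : σ₁.vars 2 = Nat.log 2 n := computeLog_spec hn hE.size
  have ha₂ : σ₂.vars 2 = Nat.log 2 n := (Cmd.vars_den ε _ σ₁ (by decide)).trans ha
  obtain ⟨m, hm, hm1, hm2⟩ := computePow_spec hE₁.size ha han.le hε hε1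
  have hK := computeThreshold_spec (ε := ε) hE₂.size ha₂ han hm b
  have harr : σ₃.arrays = σ.arrays := funext fun a =>
    (Cmd.arrays_den ε (Cmd.computeThreshold b) σ₂ (a := a)
      (by cases b <;> exact List.not_mem_nil)).trans
    ((Cmd.arrays_den ε Cmd.computePow σ₁ (a := a) (show a ∉ [] from List.not_mem_nil)).trans
    (Cmd.arrays_den ε Cmd.computeLog σ (a := a) (show a ∉ [] from List.not_mem_nil)))
  obtain ⟨t4, p, H₀, hp, t3, t1, hH₀, hcard, htree⟩ := tree_spec (ε := ε) hE₃
    (fun v => by rw [harr]; exact hzero 4 (by decide) _ _)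
    (fun u v => by rw [harr]; simpa using hzero 1 (by decide) u v)
  set σ₄ := Cmd.tree.den ε σ₃ with hσ₄
  have hE₄ : Env G s σ₄ := hE₃.den _ (by decide) (by decide) (by decide)
  set σ₅ := Cmd.countDescendants.den ε σ₄ with hσ₅
  have hE₅ : Env G s σ₅ := hE₄.den _ (by decide) (by decide) (by decide)
  have hkeep : ∀ a, a ≠ 5 → σ₅.arrays a = σ₄.arrays a := fun a ha =>
    Cmd.arrays_den ε _ σ₄ (by simpa [Cmd.countDescendants, Cmd.arrays] using ha)
  have h5 : σ₄.arrays 5 = σ.arrays 5 :=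
    (Cmd.arrays_den ε _ σ₃ (by decide)).trans (by rw [harr])
  have h2 : σ₄.arrays 2 = σ.arrays 2 :=
    (Cmd.arrays_den ε _ σ₃ (by decide)).trans (by rw [harr])
  have hK₅ : σ₅.vars 6 = 2 ^ m * (if b then Nat.log 2 n + 1 else 1) :=
    (Cmd.vars_den ε Cmd.countDescendants σ₄ (by decide)).trans
      ((Cmd.vars_den ε Cmd.tree σ₃ (by decide)).trans hK)
  obtain ⟨H, r1, r2, r3, r4⟩ := treatEdges_spec (ε := ε) hE₅ hp
    (fun v => by rw [hkeep 3 (by decide)]; exact t3 v)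
    (fun v => by rw [hkeep 4 (by decide)]; exact t4 v) hK₅
    (fun x j hj => countDescendants_spec (ε := ε) hE₄ t3
      (fun x j => by rw [h5]; exact hzero 5 (by decide) _ _) x hj)
    (H₀ := H₀) (fun u v => by rw [hkeep 1 (by decide)]; exact t1 u v) hH₀ htree
    (fun u v => by rw [hkeep 2 (by decide), h2]; simpa using hzero 2 (by decide) u v)
  exact ⟨p, m, _, H₀, H, hp, hm1, hm2, rfl, hcard, htree, r2, r3, r1, r4⟩

theorem main_halts (G : SimpleGraph (Fin n)) (s : Fin n) (ε : ℝ) (b : Bool) :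
    HaltsWithin (Cmd.main b).toProg ((Cmd.main b).time.eval n) G s ε
      ((Cmd.main b).den ε (inputState G s)) := by
  obtain ⟨t, ht, he⟩ := Cmd.exec_den ε (Cmd.main b) (inputState G s) (Cmd.wellFormed_main b)
  refine ⟨t, ?_, he⟩
  simpa [inputState] using ht

theorem Certified.ncard_le_sqrt {K : ℕ} {H₀ H : Set (Sym2 (Fin n))} (hp : IsParent G s p)
    (h : Certified G s p K H₀ H) (h₀ : H₀.ncard ≤ n) :
    (H.ncard : ℝ) ≤ 4 * (n : ℝ) ^ (3 / 2 : ℝ) := by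
  have hn : 0 < n := s.pos
  have hn1 : (1 : ℝ) ≤ n := by exact_mod_cast hn
  have h1 := h.ncard_le (m := 2 * Nat.sqrt (Fintype.card (Fin n)) + 1)
    fun v X u hX _ => hX.card_le_sqrt hp
  rw [Fintype.card_fin] at h1
  have h2 : H.ncard ≤ n + n * (2 * Nat.sqrt n + 1) := by omega
  have h3 : (H.ncard : ℝ) ≤ n + n * (2 * Nat.sqrt n + 1) := by exact_mod_cast h2
  have h4 : (Nat.sqrt n : ℝ) ≤ √n := Real.nat_sqrt_le_real_sqrt
  have h5 : 1 ≤ √(n : ℝ) := Real.one_le_sqrt.2 hn1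
  have h6 : (n : ℝ) ^ (3 / 2 : ℝ) = n * √n := by
    rw [show (3 / 2 : ℝ) = 1 + 1 / 2 by norm_num, Real.rpow_add (by linarith), Real.rpow_one,
      Real.sqrt_eq_rpow]
  rw [h6]
  nlinarith [mul_le_mul_of_nonneg_left h4 (by linarith : (0 : ℝ) ≤ n),
    mul_le_mul_of_nonneg_left h5 (by linarith : (0 : ℝ) ≤ n)]

theorem Certified.ncard_le_log {K : ℕ} {H₀ H : Set (Sym2 (Fin n))} (hp : IsParent G s p)
    (h : Certified G s p K H₀ H) (h₀ : H₀.ncard ≤ n) :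
    (H.ncard : ℝ) ≤ n * ((Nat.log 2 n + 1) * (2 * K) + 2) := by
  have h1 := h.ncard_le (m := (Nat.log 2 (Fintype.card (Fin n)) + 1) * (2 * K) + 1)
    fun v X u hX hXK => hX.card_le_log hp hXK
  rw [Fintype.card_fin] at h1
  have h2 : H.ncard ≤ n * ((Nat.log 2 n + 1) * (2 * K) + 2) := by
    calc H.ncard ≤ n + n * ((Nat.log 2 n + 1) * (2 * K) + 1) := by omega
      _ = _ := by ring
  exact_mod_cast h2

theorem natLog_le_lg (hn : 0 < n) : (Nat.log 2 n : ℝ) ≤ lg n := by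
  rw [lg, Real.le_logb_iff_rpow_le (by norm_num) (by exact_mod_cast hn), Real.rpow_natCast]
  exact_mod_cast Nat.pow_log_le_self 2 hn.ne'

theorem lg_lt_natLog (hn : 0 < n) : lg n < Nat.log 2 n + 1 := by
  rw [lg, Real.logb_lt_iff_lt_rpow (by norm_num) (by exact_mod_cast hn)]
  exact_mod_cast Nat.lt_pow_succ_log_self (by norm_num) n

theorem one_le_lg (hn : 2 ≤ n) : 1 ≤ lg n := by
  rw [lg, Real.le_logb_iff_rpow_le (by norm_num) (by exact_mod_cast (by omega : 0 < n)),
    Real.rpow_one]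
  exact_mod_cast hn

theorem two_rpow_lg (hn : 0 < n) : (2 : ℝ) ^ lg n = n :=
  Real.rpow_logb (by norm_num) (by norm_num) (by exact_mod_cast hn)

theorem rpow_eq_two_rpow (hn : 0 < n) (x : ℝ) : (n : ℝ) ^ x = 2 ^ (x * lg n) := by
  rw [mul_comm, Real.rpow_mul (by norm_num), two_rpow_lg hn]

theorem harmonic_le_lg (hn : 2 ≤ n) : (harmonic n : ℝ) ≤ 2 * lg n := by
  have h1 := harmonic_le_one_add_log n
  have h2 := one_le_lg hn
  have h3 : Real.log n ≤ lg n := by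
    rw [lg, Real.logb, le_div_iff₀ (Real.log_pos (by norm_num))]
    have h4 : Real.log 2 ≤ 1 := by linarith [Real.log_two_lt_d9]
    have h5 : 0 ≤ Real.log n := Real.log_natCast_nonneg n
    nlinarith
  linarith

/-- Rounding the logarithm down loses at most `ε ≤ 1` in the exponent and rounding `m` up gains less
than `1`, so each direction costs a factor of at most `2`. -/
theorem two_pow_bounds (hn : 0 < n) (hε : 0 < ε) (hε1 : ε ≤ 1) {m : ℕ}
    (h1 : ε * Nat.log 2 n ≤ m) (h2 : (m : ℝ) < ε * Nat.log 2 n + 1) :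
    (n : ℝ) ^ ε ≤ 2 * 2 ^ m ∧ (2 : ℝ) ^ m ≤ 2 * (n : ℝ) ^ ε := by
  have h3 := natLog_le_lg hn
  have h4 := lg_lt_natLog hn
  have h5 : (2 : ℝ) * 2 ^ m = 2 ^ ((m : ℝ) + 1) := by
    rw [Real.rpow_add_one (by norm_num), Real.rpow_natCast, mul_comm]
  have h6 : (2 : ℝ) * (n : ℝ) ^ ε = 2 ^ (ε * lg n + 1) := by
    rw [Real.rpow_add_one (by norm_num), rpow_eq_two_rpow hn, mul_comm]
  refine ⟨?_, ?_⟩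
  · rw [h5, rpow_eq_two_rpow hn]
    refine Real.rpow_le_rpow_of_exponent_le (by norm_num) ?_
    nlinarith
  · rw [h6, ← Real.rpow_natCast]
    refine Real.rpow_le_rpow_of_exponent_le (by norm_num) ?_
    nlinarith

/-- The correction term of `ε'` is made so that `n` to its power is `lg n / ε`. -/
theorem rpow_epsPrime (hn : 2 ≤ n) (hε : 0 < ε) :
    (n : ℝ) ^ (1 + epsPrime n ε) = n * ((n : ℝ) ^ ε * (lg n / ε)) := by
  have hn0 : 0 < n := by omega
  have hl := one_le_lg hn
  have hn' : (0 : ℝ) < n := by exact_mod_cast hn0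
  rw [Real.rpow_add hn', Real.rpow_one, epsPrime, Real.rpow_add hn']
  congr 2
  rw [rpow_eq_two_rpow hn0, div_mul_cancel₀ _ (by linarith)]
  exact Real.rpow_logb (by norm_num) (by norm_num) (by positivity)

/-- With `y = lg n / ε`, the crude bound `logb 2 y ≤ 2 * y` shows that the correction term adds at
most `2` to `ε * ε'`, and `ε * ε ≤ 1`. -/
theorem epsPrime_bounds (hn : 2 ≤ n) (hε : 0 < ε) (hε1 : ε ≤ 1) :
    0 < epsPrime n ε ∧ ε * epsPrime n ε ≤ 3 := by
  have hl := one_le_lg hn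
  set y := lg n / ε with hy
  have hy1 : 1 ≤ y := by rw [hy, le_div_iff₀ hε]; linarith
  have hlog : 0 ≤ Real.logb 2 y := Real.logb_nonneg (by norm_num) hy1
  have hlog2 : Real.logb 2 y ≤ 2 * y := by
    rw [Real.logb, div_le_iff₀ (Real.log_pos (by norm_num))]
    have h1 := Real.log_le_sub_one_of_pos (by linarith : 0 < y)
    nlinarith [Real.log_two_gt_d9]
  have hq : 0 ≤ Real.logb 2 y / lg n := div_nonneg hlog (by linarith)
  refine ⟨by rw [epsPrime]; linarith, ?_⟩
  have h2 : ε * (Real.logb 2 y / lg n) ≤ 2 := by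
    rw [← mul_div_assoc, div_le_iff₀ (by linarith)]
    calc ε * Real.logb 2 y ≤ ε * (2 * y) := mul_le_mul_of_nonneg_left hlog2 hε.le
      _ = 2 * lg n := by rw [hy]; field_simp
  rw [epsPrime, mul_add]
  nlinarith

theorem eq_empty_of_subset_edgeSet (G : SimpleGraph (Fin 1)) {H : Set (Sym2 (Fin 1))}
    (h : H ⊆ G.edgeSet) : H = ∅ := by
  refine Set.eq_empty_of_subset_empty fun e he => ?_
  induction e with
  | _ a b => exact (G.ne_of_adj (h he)) (Subsingleton.elim a b)

end Bounds
end FTBFS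

theorem theorem1 :
    ∃ C : ℝ,
      (∃ (P : FTBFS.Prog) (T : Polynomial ℕ),
        ∀ (n : ℕ) (G : SimpleGraph (Fin n)) (s : Fin n) (ε : ℝ), 0 < ε → ε ≤ 1 →
          ∃ (H : SimpleGraph (Fin n)) (τ : FTBFS.State),
            H ≤ G ∧
            FTBFS.HaltsWithin P (T.eval n) G s ε τ ∧ τ.Holds 1 H.edgeSet ∧
            (H.edgeSet.ncard : ℝ) ≤
              C * min (1 / FTBFS.epsPrime n ε * FTBFS.lg n *
                  (n : ℝ) ^ (1 + FTBFS.epsPrime n ε)) ((n : ℝ) ^ (3 / 2 : ℝ)) ∧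
            ((FTBFS.unprotected G H s).ncard : ℝ) ≤ C * (n : ℝ) ^ (1 - ε)) ∧
      (∃ (P : FTBFS.Prog) (T : Polynomial ℕ),
        ∀ (n : ℕ) (G : SimpleGraph (Fin n)) (s : Fin n) (ε : ℝ), 0 < ε → ε ≤ 1 →
          ∃ (H : SimpleGraph (Fin n)) (R : Set (Sym2 (Fin n))) (τ : FTBFS.State),
            FTBFS.HaltsWithin P (T.eval n) G s ε τ ∧ τ.Holds 1 H.edgeSet ∧ τ.Holds 2 R ∧
            FTBFS.IsFTBFS G H s R
              (C * min (1 / ε * (n : ℝ) ^ (1 + ε) * FTBFS.lg n) ((n : ℝ) ^ (3 / 2 : ℝ)))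
              (C * (1 / ε * (n : ℝ) ^ (1 - ε) * FTBFS.lg n))) := by
  -- The constant is `18 * 3`, with `18` from the edge count of the first statement and `3` from
  -- `epsPrime_bounds`; the other bounds leave slack.
  refine ⟨54, ⟨(FTBFS.Cmd.main true).toProg, (FTBFS.Cmd.main true).time, ?_⟩,
    ⟨(FTBFS.Cmd.main false).toProg, (FTBFS.Cmd.main false).time, ?_⟩⟩
  · intro n G s ε hε hε1
    obtain ⟨p, m, K, H₀, H, hp, hm1, hm2, hK, hcard, htree, hcert, hcomp, hH, -⟩ :=
      FTBFS.main_spec G s hε hε1 true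
    have hHG : H ⊆ G.edgeSet := hcert.1
    have hedge := FTBFS.edgeSet_fromEdgeSet_of_subset hHG
    have hunp := FTBFS.unprotected_subset hp hHG (fun v hv => hcert.2.1 (htree v hv)) hcomp
    refine ⟨SimpleGraph.fromEdgeSet H, _, FTBFS.fromEdgeSet_le_of_subset hHG,
      FTBFS.main_halts G s ε true, by rw [hedge]; exact hH, ?_, ?_⟩
    all_goals
      have hn0 : 0 < n := s.pos
      have hn' : (0 : ℝ) < n := by exact_mod_cast hn0
      have hX : (1 : ℝ) ≤ (n : ℝ) ^ ε := Real.one_le_rpow (by exact_mod_cast hn0) hε.le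
      have hla := FTBFS.lg_lt_natLog hn0
      have hal := FTBFS.natLog_le_lg hn0
      obtain ⟨hX1, hX2⟩ := FTBFS.two_pow_bounds hn0 hε hε1 hm1 hm2
      have hK' : (K : ℝ) = 2 ^ m * (Nat.log 2 n + 1) := by rw [hK]; simp
    · rw [hedge]
      rcases (show n = 1 ∨ 2 ≤ n by omega) with rfl | hn
      · rw [FTBFS.eq_empty_of_subset_edgeSet G hHG]
        simp [FTBFS.lg]
      have hl := FTBFS.one_le_lg hn
      rw [mul_min_of_nonneg _ _ (by norm_num)]
      refine le_min ?_ ?_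
      · obtain ⟨he1, he2⟩ := FTBFS.epsPrime_bounds hn hε hε1
        rw [FTBFS.rpow_epsPrime hn hε]
        have h1 := hcert.ncard_le_log hp hcard
        set X := (n : ℝ) ^ ε
        set l := FTBFS.lg n
        have hKl : (K : ℝ) ≤ 4 * X * l := by
          rw [hK']
          calc (2 : ℝ) ^ m * (Nat.log 2 n + 1) ≤ (2 * X) * (2 * l) :=
                mul_le_mul hX2 (by linarith) (by positivity) (by positivity)
            _ = 4 * X * l := by ring
        have h2 : (Nat.log 2 n + 1 : ℝ) * (2 * K) ≤ (2 * l) * (2 * (4 * X * l)) :=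
          mul_le_mul (by linarith) (by linarith) (by positivity) (by positivity)
        have h3 : 1 ≤ X * l ^ 2 := one_le_mul_of_one_le_of_one_le hX (one_le_pow₀ hl)
        have h4 : (H.ncard : ℝ) ≤ n * (18 * (X * l ^ 2)) :=
          h1.trans (mul_le_mul_of_nonneg_left (by linarith) hn'.le)
        refine h4.trans ?_
        -- The target is `n * X * l ^ 2` up to the factor `1 / (ε * ε')`, which is at least `1 / 3`.
        have h5 : 54 * (1 / FTBFS.epsPrime n ε * l * (n * (X * (l / ε)))) =
            n * (18 * (X * l ^ 2)) * (3 / (ε * FTBFS.epsPrime n ε)) := by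
          field_simp
          ring
        rw [h5]
        refine le_mul_of_one_le_right (by positivity) ?_
        rw [le_div_iff₀ (by positivity)]
        linarith
      · refine (hcert.ncard_le_sqrt hp hcard).trans ?_
        exact mul_le_mul_of_nonneg_right (by norm_num) (by positivity)
    · rcases (show n = 1 ∨ 2 ≤ n by omega) with rfl | hn
      · rw [FTBFS.eq_empty_of_subset_edgeSet G
          (H := FTBFS.unprotected G (SimpleGraph.fromEdgeSet H) s) (fun e he => he.1)]
        simp
      have hl := FTBFS.one_le_lg hn
      have hK0 : 0 < K := by rw [hK]; positivity
      have h1 := FTBFS.ncard_denseEdges_le p hK0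
      have h2 : ((FTBFS.unprotected G (SimpleGraph.fromEdgeSet H) s).ncard : ℝ) ≤
          (FTBFS.denseEdges p K).ncard := by
        exact_mod_cast Set.ncard_le_ncard hunp (Set.toFinite _)
      refine h2.trans (h1.trans ?_)
      rw [Fintype.card_fin, div_le_iff₀ (by exact_mod_cast hK0), Real.rpow_sub hn', Real.rpow_one]
      have h3 := FTBFS.harmonic_le_lg hn
      set X := (n : ℝ) ^ ε
      set l := FTBFS.lg n
      -- The extra logarithm in the threshold cancels the harmonic number, so no logarithm remains
      -- in the number of unprotected edges.
      have h4 : X * l ≤ 2 * K := by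
        rw [hK', ← mul_assoc]
        exact mul_le_mul hX1 hla.le (by linarith) (by positivity)
      calc (n : ℝ) * (harmonic n : ℝ) ≤ n * (2 * l) := mul_le_mul_of_nonneg_left h3 hn'.le
        _ = 2 * (n / X) * (X * l) := by field_simp
        _ ≤ 2 * (n / X) * (2 * K) := mul_le_mul_of_nonneg_left h4 (by positivity)
        _ = 4 * (n / X * K) := by ring
        _ ≤ 54 * (n / X * K) := mul_le_mul_of_nonneg_right (by norm_num) (by positivity)
        _ = 54 * (n / X) * K := by ring
  · intro n G s ε hε hε1
    obtain ⟨p, m, K, H₀, H, hp, hm1, hm2, hK, hcard, htree, hcert, hcomp, hH, hR⟩ :=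
      FTBFS.main_spec G s hε hε1 false
    have hHG : H ⊆ G.edgeSet := hcert.1
    have hedge := FTBFS.edgeSet_fromEdgeSet_of_subset hHG
    have htree' : ∀ v, p v ≠ v → s(p v, v) ∈ H := fun v hv => hcert.2.1 (htree v hv)
    have hRH : FTBFS.denseEdges p K ⊆ H := by
      rintro e ⟨x, hx, -, rfl⟩
      exact htree' x hx
    refine ⟨SimpleGraph.fromEdgeSet H, FTBFS.denseEdges p K, _,
      FTBFS.main_halts G s ε false, by rw [hedge]; exact hH, hR,
      ⟨FTBFS.fromEdgeSet_le_of_subset hHG, by rw [hedge]; exact hRH, ?_, ?_,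
        fun e he v => FTBFS.edist_le_of_complete hp htree' hcomp he.2 v⟩⟩
    all_goals
      have hn0 : 0 < n := s.pos
      have hn' : (0 : ℝ) < n := by exact_mod_cast hn0
      have hX : (1 : ℝ) ≤ (n : ℝ) ^ ε := Real.one_le_rpow (by exact_mod_cast hn0) hε.le
      have hal := FTBFS.natLog_le_lg hn0
      obtain ⟨hX1, hX2⟩ := FTBFS.two_pow_bounds hn0 hε hε1 hm1 hm2
      have hK' : (K : ℝ) = 2 ^ m := by rw [hK]; simp
      have hε' : 1 ≤ 1 / ε := by rw [le_div_iff₀ hε]; linarith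
    · rw [hedge]
      have h0 : ((H \ FTBFS.denseEdges p K).ncard : ℝ) ≤ H.ncard := by
        exact_mod_cast Set.ncard_le_ncard Set.sdiff_subset (Set.toFinite _)
      refine h0.trans ?_
      rcases (show n = 1 ∨ 2 ≤ n by omega) with rfl | hn
      · rw [FTBFS.eq_empty_of_subset_edgeSet G hHG]
        simp [FTBFS.lg]
      have hl := FTBFS.one_le_lg hn
      rw [mul_min_of_nonneg _ _ (by norm_num)]
      refine le_min ?_ ?_
      · have h1 := hcert.ncard_le_log hp hcard
        rw [Real.rpow_add hn', Real.rpow_one]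
        set X := (n : ℝ) ^ ε
        set l := FTBFS.lg n
        have h2 : (Nat.log 2 n + 1 : ℝ) * (2 * K) ≤ (2 * l) * (2 * (2 * X)) :=
          mul_le_mul (by linarith) (by linarith) (by positivity) (by positivity)
        have h3 : 1 ≤ X * l := one_le_mul_of_one_le_of_one_le hX hl
        calc (H.ncard : ℝ) ≤ n * (54 * (X * l)) :=
              h1.trans (mul_le_mul_of_nonneg_left (by linarith) hn'.le)
          _ ≤ n * (54 * (X * l)) * (1 / ε) := le_mul_of_one_le_right (by positivity) hε'
          _ = 54 * (1 / ε * (n * X) * l) := by ring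
      · refine (hcert.ncard_le_sqrt hp hcard).trans ?_
        exact mul_le_mul_of_nonneg_right (by norm_num) (by positivity)
    · rcases (show n = 1 ∨ 2 ≤ n by omega) with rfl | hn
      · rw [FTBFS.eq_empty_of_subset_edgeSet G (hRH.trans hHG)]
        simp [FTBFS.lg]
      have hl := FTBFS.one_le_lg hn
      have hK0 : 0 < K := by rw [hK]; positivity
      refine (FTBFS.ncard_denseEdges_le p hK0).trans ?_
      rw [Fintype.card_fin, div_le_iff₀ (by exact_mod_cast hK0), Real.rpow_sub hn', Real.rpow_one]
      have h3 := FTBFS.harmonic_le_lg hn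
      rw [← hK'] at hX1
      set X := (n : ℝ) ^ ε
      set l := FTBFS.lg n
      calc (n : ℝ) * (harmonic n : ℝ) ≤ n * (2 * l) := mul_le_mul_of_nonneg_left h3 hn'.le
        _ = 2 * (n / X) * l * X := by field_simp
        _ ≤ 2 * (n / X) * l * (2 * K) := mul_le_mul_of_nonneg_left hX1 (by positivity)
        _ = 4 * (n / X * l * K) := by ring
        _ ≤ 54 * (n / X * l * K) := mul_le_mul_of_nonneg_right (by norm_num) (by positivity)
        _ ≤ 54 * (n / X * l * K) * (1 / ε) := le_mul_of_one_le_right (by positivity) hε'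
        _ = 54 * (1 / ε * (n / X) * l) * K := by ring
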